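/- Let $\alpha$ be a Salem number, i.e. a real algebraic integer $\alpha>1$ all of whose other conjugates have modulus at most $1$, at least one of them having modulus exactly $1$. Let $A\in GL(d,\mathbb Z)$ be a matrix whose characteristic polynomial is the minimal polynomial of $\alpha$ over $\mathbb Q$ (so $A$ is irreducible over $\mathbb Q$). Let $\Gamma\subset\mathbb Z^d$ be a full-rank lattice with $A\Gamma\subset\Gamma$ or $A^{\mathsf T}\Gamma\subset\Gamma$, let $\Gamma^*=\{u\in\mathbb R^d:\langle u,z\rangle\in\mathbb Z\text{ for all }z\in\Gamma\}$ be the dual lattice, and write $\|u\|_{\mathbb R^d/\Gamma^*}=\inf_{v\in\Gamma^*}\|u-v\|_\infty$. Let $\mathbf 1=(1,\dots,1)^{\mathsf T}$, and let $\sigma_0:\mathbb Q(\alpha)\to\mathbb C$ be the embedding with $\sigma_0(\alpha)=\alpha^{-1}$. For $\omega\in\mathbb Q(\alpha)$ let $L\ge 1$ be its denominator: $\omega=(l_0+l_1\alpha+\dots+l_{d-1}\alpha^{d-1})/L$ with $l_i\in\mathbb Z$ and $\gcd(l_0,\dots,l_{d-1},L)=1$. Then there is a function $\delta(x,y,L)>0$,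 depending only on $A$ and $\Gamma$, which is effective in the following sense: there is a computable function $D:\mathbb N^3\to\mathbb N$ such that $\delta(x,y,L)\ge 1/(D(M,K,L)+1)$ for all real $x,y$ and all natural numbers $M\ge x$, $K\ge y$ and $L$; and such that for every $\omega\in(0,1)\cap\mathbb Q(\alpha)$, with denominator $L$, at least one of the following holds: (i) $\omega\mathbf 1\in\Gamma^*$; (ii) with $\delta=\delta(|\omega|,|\sigma_0(\omega)|,L)$, the limit $$\lim_{N\to\infty}\frac1N\#\bigl\{n\le N:\ \|\omega A^n\mathbf 1\|_{\mathbb R^d/\Gamma^*}\ge\delta\bigr\}$$ exists and is at least $\dfrac1{2L^d}$. -/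

import Mathlib

open Filter Topology
open scoped IntermediateField

/-- A Salem number: a real algebraic integer `α > 1` all of whose other conjugates have modulus at
most `1`, at least one of them having modulus exactly `1`. -/
structure IsSalemNumber (α : ℝ) : Prop where
  isIntegral : IsIntegral ℤ α
  one_lt : 1 < α
  norm_le_one : ∀ z ∈ (minpoly ℚ α).aroots ℂ, z ≠ (α : ℂ) → ‖z‖ ≤ 1
  exists_norm_eq_one : ∃ z ∈ (minpoly ℚ α).aroots ℂ, ‖z‖ = 1

theorem IsSalemNumber.isIntegral_rat {α : ℝ} (h : IsSalemNumber α) : IsIntegral ℚ α :=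
  h.isIntegral.tower_top

/-- The inverse of a Salem number is one of its conjugates. -/
theorem IsSalemNumber.inv_mem_aroots {α : ℝ} (h : IsSalemNumber α) :
    ((α : ℂ))⁻¹ ∈ (minpoly ℚ α).aroots ℂ := by
  obtain ⟨z, hz, hz1⟩ := h.exists_norm_eq_one
  have hp0 : minpoly ℚ α ≠ 0 := minpoly.ne_zero h.isIntegral_rat
  rw [Polynomial.mem_aroots] at hz ⊢
  refine ⟨hp0, ?_⟩
  have hzz : Polynomial.aeval z⁻¹ (minpoly ℚ α) = 0 := by
    have h1 : z⁻¹ = (starRingEnd ℂ) z := by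
      rw [Complex.inv_def, Complex.normSq_eq_norm_sq, hz1]; simp
    have h2 := Polynomial.aeval_algHom_apply (Complex.conjAe.toAlgHom.restrictScalars ℚ) z
      (minpoly ℚ α)
    rw [hz.2, map_zero] at h2
    rw [h1]
    exact h2
  have hrev : Polynomial.aeval z (minpoly ℚ α).reverse = 0 := by
    have hz0 : z⁻¹ ≠ 0 := by
      intro h0
      rw [inv_eq_zero.1 h0, norm_zero] at hz1
      exact zero_ne_one hz1
    let _ := invertibleOfNonzero hz0
    have := (Polynomial.eval₂_reverse_eq_zero_iff (algebraMap ℚ ℂ) z⁻¹ (minpoly ℚ α)).2 hzz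
    rwa [invOf_eq_inv, inv_inv] at this
  have hmz : minpoly ℚ α = minpoly ℚ z :=
    minpoly.eq_of_irreducible_of_monic (minpoly.irreducible h.isIntegral_rat) hz.2
      (minpoly.monic h.isIntegral_rat)
  have hdvd : minpoly ℚ α ∣ (minpoly ℚ α).reverse := by
    conv_lhs => rw [hmz]
    exact minpoly.dvd ℚ z hrev
  have hα : Polynomial.aeval (α : ℂ) (minpoly ℚ α) = 0 := by
    have := Polynomial.aeval_algebraMap_apply ℂ α (minpoly ℚ α)
    rw [minpoly.aeval, map_zero] at this
    exact this
  have hα' : Polynomial.aeval (α : ℂ) (minpoly ℚ α).reverse = 0 := by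
    obtain ⟨q, hq⟩ := hdvd
    rw [hq, map_mul, hα, zero_mul]
  have hα0 : ((α : ℂ))⁻¹ ≠ 0 :=
    inv_ne_zero (Complex.ofReal_ne_zero.2 (zero_lt_one.trans h.one_lt).ne')
  let _ := invertibleOfNonzero hα0
  have := (Polynomial.eval₂_reverse_eq_zero_iff (algebraMap ℚ ℂ) ((α : ℂ))⁻¹ (minpoly ℚ α)).1
  rw [invOf_eq_inv, inv_inv] at this
  exact this hα'

/-- The embedding `σ₀ : ℚ(α) → ℂ` that sends the Salem number `α` to `α⁻¹`. -/
noncomputable def IsSalemNumber.invEmbedding {α : ℝ} (h : IsSalemNumber α) : ℚ⟮α⟯ →ₐ[ℚ] ℂ :=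
  (IntermediateField.algHomAdjoinIntegralEquiv ℚ h.isIntegral_rat).symm
    ⟨((α : ℂ))⁻¹, h.inv_mem_aroots⟩

theorem IsSalemNumber.invEmbedding_gen {α : ℝ} (h : IsSalemNumber α) :
    h.invEmbedding (IntermediateField.AdjoinSimple.gen ℚ α) = ((α : ℂ))⁻¹ :=
  IntermediateField.algHomAdjoinIntegralEquiv_symm_apply_gen ℚ h.isIntegral_rat _

/-- `ω = (l₀ + l₁ α + ⋯ + l_{d-1} α^{d-1}) / L` with `L ≥ 1` and `gcd(l₀, …, l_{d-1}, L) = 1`. If `α`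
is of degree `d`, then this determines `l` and `L`, and `L` is the denominator of `ω`. -/
structure IsMinimalForm {d : ℕ} (α ω : ℝ) (l : Fin d → ℤ) (L : ℕ) : Prop where
  pos : 0 < L
  eq : ω = (∑ i : Fin d, (l i : ℝ) * α ^ (i : ℕ)) / (L : ℝ)
  gcd_eq_one : Nat.gcd (Finset.univ.gcd fun i => (l i).natAbs) L = 1

/-- The dual `Γ* = {u ∈ ℝᵈ : ⟨u, z⟩ ∈ ℤ for all z ∈ Γ}` of `Γ ⊆ ℤᵈ`. -/
def dualLattice {d : ℕ} (Γ : Submodule ℤ (Fin d → ℤ)) : Set (Fin d → ℝ) :=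
  {u | ∀ z ∈ Γ, ∃ k : ℤ, ∑ i, u i * (z i : ℝ) = (k : ℝ)}

/-- `‖u‖_{ℝᵈ/Γ*}`: the distance from `u` to `Γ*` in the norm `‖·‖_∞`, which is the norm of
`Fin d → ℝ`. -/
noncomputable def torusNorm {d : ℕ} (Γ : Submodule ℤ (Fin d → ℤ)) (u : Fin d → ℝ) : ℝ :=
  Metric.infDist u (dualLattice Γ)

/-- The vector `ω Aⁿ 𝟏 ∈ ℝᵈ`, where `𝟏 = (1, …, 1)ᵀ`. -/
def orbitVec {d : ℕ} (A : GL (Fin d) ℤ) (ω : ℝ) (n : ℕ) : Fin d → ℝ :=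
  ω • (((A : Matrix (Fin d) (Fin d) ℤ) ^ n).map (Int.cast : ℤ → ℝ)).mulVec (fun _ => 1)

/-- Effective positivity of a function `δ(x, y, L)`: there is an algorithm which, given natural
numbers `M`, `K`, `L`, computes a positive rational lower bound for all the values `δ(x, y, L)` with
`x ≤ M` and `y ≤ K`. -/
def IsEffectivelyPositive (δ : ℝ → ℝ → ℕ → ℝ) : Prop :=
  ∃ D : ℕ × ℕ × ℕ → ℕ, Computable D ∧
    ∀ (x y : ℝ) (M K L : ℕ), x ≤ M → y ≤ K → 1 / ((D (M, K, L) : ℝ) + 1) ≤ δ x y L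

/-!
# Distribution modulo a dual lattice of the orbit of a vector under a Salem matrix

The conjugates of the Salem number `α` are `α`, `α⁻¹` and pairs `z, z̄` on the unit circle; let
`J` be the set of those in the upper half plane. Write `ω = P(α) / L` with `P ∈ ℤ[X]` and
decompose `𝟏 = ∑ v_b` into eigenvectors of `A` (`eigenComponent`); all `v_b` are nonzero because
the characteristic polynomial of `A` is irreducible. Then `ω Aⁿ 𝟏 - L⁻¹ P(A) Aⁿ 𝟏 = ∑_b (ω - P(b)
/ L) bⁿ v_b`. The term of `b = α` vanishes, that of `b = α⁻¹` tends to `0`, and the others form a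
trigonometric polynomial evaluated along the rotation of the torus `(ℝ/ℤ)^J` by the arguments of
the `z ∈ J` (`IsSalemNumber.orbit_eq`). The vectors `L⁻¹ P(A) Aⁿ 𝟏` are periodic modulo `ℤᵈ ⊆ Γ*`,
because `A` is invertible modulo `L`.

An embedding that sends one `z ∈ J` to `α` sends the other elements of `J` to the unit circle, so
the `z ∈ J` are multiplicatively independent (`IsSalemNumber.eq_zero_of_prod_zpow_eq_one`) and the
rotation is equidistributed (`average_comp_tendsto`). Hence, along each residue class modulo the
period, `‖ω Aⁿ 𝟏‖` has a limit distribution, and the density of `{n | δ ≤ ‖ω Aⁿ 𝟏‖}` exists for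
all but countably many `δ`. As `ω > 0` is determined by `|ω|`, the value `δ(|ω|, |σ₀(ω)|, L)` may
be chosen to avoid these exceptions.

If `P` takes the same value at `α` and on all of `J`, then `P` is constant
(`IsSalemNumber.eq_C_of_aeval_eq`), so `ω Aⁿ 𝟏` is periodic modulo `ℤᵈ` with a period of at most
`Lᵈ`, and if `ω 𝟏 ∉ Γ*`, then the initial point alone gives density at least `L⁻ᵈ`
(`exists_density_of_rational`). Otherwise some `|ω - P(z) / L|` with `z ∈ J` is bounded from
below: if all of them are less than `1`, then all conjugates of `ω` are bounded in terms of `|ω|`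
and `|σ₀(ω)|`, and a nonzero integer, the norm of `P(α) - P(z)`, is at least `1` in modulus
(`IsSalemNumber.exists_conjugate_difference_ge`). In this case a coordinate of a multiple of `ω Aⁿ
𝟏` behaves like `c + R cos θ` with `R` bounded from below and `θ` uniformly distributed, which is
close to an integer with probability at most `1 / 2` (`measureReal_near_int_le_half`), so the
density is at least `1 / 2`. All bounds are explicit polynomials in `|ω|`, `|σ₀(ω)|` and `L`
(`effectiveBound`).
-/

open MeasureTheory

/-! ### Equidistribution of rotations of the torus -/

theorem mFourier_add_apply {J : Type*} [Fintype J] (n : J → ℤ) (x y : UnitAddTorus J) :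
    UnitAddTorus.mFourier n (x + y) = UnitAddTorus.mFourier n x * UnitAddTorus.mFourier n y := by
  simp [UnitAddTorus.mFourier, Finset.prod_mul_distrib, fourier_apply, smul_add,
    AddCircle.toCircle_add]

theorem mFourier_nsmul_apply {J : Type*} [Fintype J] (n : J → ℤ) (x : UnitAddTorus J) (k : ℕ) :
    UnitAddTorus.mFourier n (k • x) = UnitAddTorus.mFourier n x ^ k := by
  induction k with
  | zero => simp [UnitAddTorus.mFourier]
  | succ k ih => rw [succ_nsmul, mFourier_add_apply, ih, pow_succ]

/-- Weyl's equidistribution theorem for a rotation `y` of the torus that is not killed by any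
nontrivial character. -/
theorem birkhoffAverage_comp_tendsto {J : Type*} [Fintype J]
    (μ : Measure (UnitAddTorus J)) [IsProbabilityMeasure μ] [μ.IsAddLeftInvariant]
    (y : UnitAddTorus J) (hy : ∀ n : J → ℤ, n ≠ 0 → UnitAddTorus.mFourier n y ≠ 1)
    (g : C(UnitAddTorus J, ℂ)) (a : UnitAddTorus J) :
    Tendsto (fun N : ℕ => (N : ℂ)⁻¹ * ∑ k ∈ Finset.range N, g (a + k • y)) atTop
      (𝓝 (∫ t, g t ∂μ)) := by
  let E : Submodule ℂ C(UnitAddTorus J, ℂ) :=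
    { carrier := {g | Tendsto (fun N : ℕ => (N : ℂ)⁻¹ * ∑ k ∈ Finset.range N, g (a + k • y)) atTop
        (𝓝 (∫ t, g t ∂μ))}
      zero_mem' := by simp
      add_mem' := fun {f g} hf hg => by
        have hi : ∀ f : C(UnitAddTorus J, ℂ), Integrable f μ := fun f =>
          f.continuous.integrable_of_hasCompactSupport (HasCompactSupport.of_compactSpace _)
        simp only [Set.mem_ofPred_eq, ContinuousMap.add_apply] at hf hg ⊢
        rw [integral_add (hi f) (hi g)]
        simpa only [Finset.sum_add_distrib, mul_add] using hf.add hg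
      smul_mem' := fun c f hf => by
        simp only [Set.mem_ofPred_eq, ContinuousMap.smul_apply, smul_eq_mul] at hf ⊢
        rw [integral_const_mul]
        simpa only [← Finset.mul_sum, mul_left_comm] using hf.const_mul c }
  have hmono : Submodule.span ℂ (Set.range UnitAddTorus.mFourier) ≤ E := by
    rw [Submodule.span_le]
    rintro _ ⟨n, rfl⟩
    change Tendsto _ _ _
    simp only [mFourier_add_apply, mFourier_nsmul_apply, ← Finset.mul_sum]
    by_cases hn : n = 0
    · subst hn
      simp only [UnitAddTorus.mFourier_zero, ContinuousMap.one_apply, integral_const, one_pow]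
      refine tendsto_const_nhds.congr' ?_
      filter_upwards [eventually_ne_atTop 0] with N hN
      simp [hN]
    · have h1 := hy n hn
      set z := UnitAddTorus.mFourier n y with hz
      -- translation by `y` multiplies the character by `z ≠ 1` and preserves the integral
      have hint : ∫ t, UnitAddTorus.mFourier n t ∂μ = 0 := by
        have h2 := integral_add_left_eq_self (μ := μ) (fun t => UnitAddTorus.mFourier n t) y
        simp only [mFourier_add_apply] at h2
        rw [integral_const_mul, ← hz] at h2
        have h3 : (z - 1) * ∫ t, UnitAddTorus.mFourier n t ∂μ = 0 := by
          rw [sub_mul, h2, one_mul, sub_self]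
        exact (mul_eq_zero.1 h3).resolve_left (sub_ne_zero.2 h1)
      rw [hint]
      have hnorm : ∀ t, ‖UnitAddTorus.mFourier n t‖ = 1 := fun t => by
        simp only [UnitAddTorus.mFourier, ContinuousMap.coe_mk, norm_prod, fourier_apply,
          Circle.norm_coe, Finset.prod_const_one]
      have hb : ∀ N : ℕ, ‖UnitAddTorus.mFourier n a * ∑ k ∈ Finset.range N, z ^ k‖ ≤
          2 / ‖z - 1‖ := by
        intro N
        rw [norm_mul, hnorm, one_mul, geom_sum_eq h1, norm_div]
        gcongr
        refine (norm_sub_le _ _).trans ?_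
        rw [norm_pow, hz, hnorm]
        norm_num
      refine squeeze_zero_norm (a := fun N : ℕ => (N : ℝ)⁻¹ * (2 / ‖z - 1‖)) (fun N => ?_) ?_
      · rw [norm_mul, norm_inv, Complex.norm_natCast]
        gcongr
        exact hb N
      · simpa using (tendsto_inv_atTop_nhds_zero_nat (𝕜 := ℝ)).mul_const (2 / ‖z - 1‖)
  have hdense : g ∈ (Submodule.span ℂ
      (Set.range (UnitAddTorus.mFourier (d := J)))).topologicalClosure := by
    rw [UnitAddTorus.span_mFourier_closure_eq_top]; trivial
  rw [Metric.tendsto_atTop]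
  intro ε hε
  obtain ⟨h, hh, hgh⟩ := Metric.mem_closure_iff.1 hdense (ε / 3) (by positivity)
  have hE : Tendsto _ _ _ := hmono hh
  obtain ⟨N₀, hN₀⟩ := Metric.tendsto_atTop.1 hE (ε / 3) (by positivity)
  have hpt : ∀ t, ‖g t - h t‖ ≤ ε / 3 := fun t => by
    rw [← dist_eq_norm]; exact (ContinuousMap.dist_apply_le_dist t).trans hgh.le
  have hi : ∀ f : C(UnitAddTorus J, ℂ), Integrable f μ := fun f =>
          f.continuous.integrable_of_hasCompactSupport (HasCompactSupport.of_compactSpace _)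
  refine ⟨N₀, fun N hN => ?_⟩
  have h1 := hN₀ N hN
  rw [dist_eq_norm] at h1 ⊢
  have h2 : ‖(N : ℂ)⁻¹ * ∑ k ∈ Finset.range N, g (a + k • y) -
      (N : ℂ)⁻¹ * ∑ k ∈ Finset.range N, h (a + k • y)‖ ≤ ε / 3 := by
    rw [← mul_sub, ← Finset.sum_sub_distrib, norm_mul, norm_inv, Complex.norm_natCast]
    have : ‖∑ k ∈ Finset.range N, (g (a + k • y) - h (a + k • y))‖ ≤ N * (ε / 3) := by
      refine (norm_sum_le_of_le _ fun k _ => hpt _).trans ?_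
      simp
    rcases Nat.eq_zero_or_pos N with rfl | hN
    · simp; positivity
    · have hN' : (0 : ℝ) < N := by exact_mod_cast hN
      rw [inv_mul_le_iff₀ hN']
      exact this
  have h3 : ‖∫ t, h t ∂μ - ∫ t, g t ∂μ‖ ≤ ε / 3 := by
    rw [← integral_sub (hi h) (hi g)]
    refine (norm_integral_le_of_norm_le_const (C := ε / 3)
      (Eventually.of_forall fun t => ?_)).trans ?_
    · rw [norm_sub_rev]; exact hpt t
    · simp
  calc _ = ‖((N : ℂ)⁻¹ * ∑ k ∈ Finset.range N, g (a + k • y) -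
      (N : ℂ)⁻¹ * ∑ k ∈ Finset.range N, h (a + k • y)) +
      ((N : ℂ)⁻¹ * ∑ k ∈ Finset.range N, h (a + k • y) - ∫ t, h t ∂μ) +
      (∫ t, h t ∂μ - ∫ t, g t ∂μ)‖ := by congr 1; ring
    _ < ε := by
      refine (norm_add₃_le).trans_lt ?_
      linarith

/-! ### Densities of superlevel sets -/

theorem average_comp_tendsto {J : Type*} [Fintype J]
    (μ : Measure (UnitAddTorus J)) [IsProbabilityMeasure μ] [μ.IsAddLeftInvariant]
    (y : UnitAddTorus J) (hy : ∀ n : J → ℤ, n ≠ 0 → UnitAddTorus.mFourier n y ≠ 1)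
    {g : UnitAddTorus J → ℝ} (hg : Continuous g) (a : UnitAddTorus J) :
    Tendsto (fun N : ℕ => (N : ℝ)⁻¹ * ∑ k ∈ Finset.range N, g (a + k • y)) atTop
      (𝓝 (∫ t, g t ∂μ)) := by
  have h := birkhoffAverage_comp_tendsto μ y hy
    ⟨fun t => (g t : ℂ), Complex.continuous_ofReal.comp hg⟩ a
  simp only [ContinuousMap.coe_mk, integral_complex_ofReal] at h
  have h' := (Complex.continuous_re.tendsto _).comp h
  rw [Complex.ofReal_re] at h'
  refine h'.congr fun N => ?_
  have : (N : ℂ)⁻¹ * ∑ k ∈ Finset.range N, (g (a + k • y) : ℂ) =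
    (((N : ℝ)⁻¹ * ∑ k ∈ Finset.range N, g (a + k • y) : ℝ) : ℂ) := by push_cast; rfl
  rw [Function.comp_apply, this, Complex.ofReal_re]

/-- For `η > 0` this function rises from `0` at `u` to `1` at `u + η`; it replaces indicator
functions of half-lines. -/
theorem continuous_ramp (u η : ℝ) : Continuous fun t : ℝ => max 0 (min 1 ((t - u) / η)) := by
  fun_prop

/-- The measure of `{u ≤ G}` is left continuous in `u`. -/
theorem measureReal_superlevel_tendsto_left {Ω : Type*} [MeasurableSpace Ω] (μ : Measure Ω)
    [IsFiniteMeasure μ] {G : Ω → ℝ} (hG : Measurable G) (δ : ℝ) :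
    Tendsto (fun n : ℕ => μ.real {t | δ - 2 * (1 / ((n : ℝ) + 1)) ≤ G t}) atTop
      (𝓝 (μ.real {t | δ ≤ G t})) := by
  have hmono : Antitone fun n : ℕ => {t | δ - 2 * (1 / ((n : ℝ) + 1)) ≤ G t} := by
    intro m n hmn t ht
    have := Nat.one_div_le_one_div (α := ℝ) hmn
    simp only [Set.mem_ofPred_eq] at ht ⊢
    linarith
  have h := tendsto_measure_iInter_atTop (μ := μ)
    (fun n : ℕ => (measurableSet_le measurable_const hG :
      MeasurableSet {t | δ - 2 * (1 / ((n : ℝ) + 1)) ≤ G t}).nullMeasurableSet) hmono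
    ⟨0, measure_ne_top _ _⟩
  have heq : ⋂ n : ℕ, {t | δ - 2 * (1 / ((n : ℝ) + 1)) ≤ G t} = {t | δ ≤ G t} := by
    ext t
    simp only [Set.mem_iInter, Set.mem_ofPred_eq]
    constructor
    · intro h
      have hl : Tendsto (fun n : ℕ => δ - 2 * (1 / ((n : ℝ) + 1))) atTop (𝓝 (δ - 2 * 0)) :=
        (tendsto_one_div_add_atTop_nhds_zero_nat.const_mul 2).const_sub δ
      simpa using le_of_tendsto' hl h
    · intro h n
      have : (0 : ℝ) < 1 / ((n : ℝ) + 1) := by positivity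
      linarith
  rw [heq] at h
  exact (ENNReal.tendsto_toReal (measure_ne_top _ _)).comp h

/-- The measure of `{u ≤ G}` is right continuous at a level `δ` without mass. -/
theorem measureReal_superlevel_tendsto_right {Ω : Type*} [MeasurableSpace Ω] (μ : Measure Ω)
    [IsFiniteMeasure μ] {G : Ω → ℝ} {δ : ℝ} (hδ : μ {t | G t = δ} = 0) :
    Tendsto (fun n : ℕ => μ.real {t | δ + 2 * (1 / ((n : ℝ) + 1)) ≤ G t}) atTop
      (𝓝 (μ.real {t | δ ≤ G t})) := by
  have hmono : Monotone fun n : ℕ => {t | δ + 2 * (1 / ((n : ℝ) + 1)) ≤ G t} := by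
    intro m n hmn t ht
    have := Nat.one_div_le_one_div (α := ℝ) hmn
    simp only [Set.mem_ofPred_eq] at ht ⊢
    linarith
  have h := tendsto_measure_iUnion_atTop (μ := μ) hmono
  have heq : ⋃ n : ℕ, {t | δ + 2 * (1 / ((n : ℝ) + 1)) ≤ G t} = {t | δ < G t} := by
    ext t
    simp only [Set.mem_iUnion, Set.mem_ofPred_eq]
    constructor
    · rintro ⟨n, hn⟩
      have : (0 : ℝ) < 1 / ((n : ℝ) + 1) := by positivity
      linarith
    · intro h
      obtain ⟨n, hn⟩ := exists_nat_one_div_lt (half_pos (sub_pos.2 h))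
      exact ⟨n, by linarith⟩
  have heq' : μ {t | δ < G t} = μ {t | δ ≤ G t} := by
    refine le_antisymm (measure_mono fun t (ht : δ < G t) => ht.le) ?_
    calc μ {t | δ ≤ G t} ≤ μ ({t | δ < G t} ∪ {t | G t = δ}) :=
          measure_mono fun t (ht : δ ≤ G t) => ht.lt_or_eq.imp id Eq.symm
      _ ≤ μ {t | δ < G t} + μ {t | G t = δ} := measure_union_le _ _
      _ = μ {t | δ < G t} := by rw [hδ, add_zero]
  rw [heq, heq'] at h
  exact (ENNReal.tendsto_toReal (measure_ne_top _ _)).comp h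

/-- If `F` is asymptotic to a continuous function `G` along an equidistributed orbit, then the
density of `{k | δ ≤ F k}` is the measure of `{δ ≤ G}`, for every level `δ` that has no mass. -/
theorem density_superlevel_tendsto {J : Type*} [Fintype J]
    (μ : Measure (UnitAddTorus J)) [IsProbabilityMeasure μ] [μ.IsAddLeftInvariant]
    (y : UnitAddTorus J) (hy : ∀ n : J → ℤ, n ≠ 0 → UnitAddTorus.mFourier n y ≠ 1)
    {G : UnitAddTorus J → ℝ} (hG : Continuous G) (a : UnitAddTorus J) {F : ℕ → ℝ}
    (hF : Tendsto (fun k => F k - G (a + k • y)) atTop (𝓝 0))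
    {δ : ℝ} (hδ : μ {t | G t = δ} = 0) :
    Tendsto (fun N : ℕ => (N : ℝ)⁻¹ * ∑ k ∈ Finset.range N, if δ ≤ F k then (1 : ℝ) else 0) atTop
      (𝓝 (μ.real {t | δ ≤ G t})) := by
  have hint : ∀ u η, Integrable (fun t => max 0 (min 1 ((G t - u) / η))) μ := fun u η =>
    ((continuous_ramp u η).comp hG).integrable_of_hasCompactSupport
      (HasCompactSupport.of_compactSpace _)
  have hmeas : ∀ u, MeasurableSet {t | u ≤ G t} := fun u =>
    measurableSet_le measurable_const hG.measurable
  have hind : ∀ u, ∫ t, (if u ≤ G t then (1 : ℝ) else 0) ∂μ = μ.real {t | u ≤ G t} := fun u => by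
    rw [← integral_indicator_one (hmeas u)]
    congr 1
  have hindi : ∀ u, Integrable (fun t => if u ≤ G t then (1 : ℝ) else 0) μ := fun u =>
    (integrable_indicator_iff (hmeas u)).2 (integrable_const (1 : ℝ)).integrableOn
  -- finitely many terms do not matter
  have htail : ∀ k₀ : ℕ, Tendsto (fun N : ℕ => (N : ℝ)⁻¹ *
      ∑ k ∈ Finset.range N, if k < k₀ then (1 : ℝ) else 0) atTop (𝓝 0) := fun k₀ => by
    refine squeeze_zero' (Eventually.of_forall fun N => ?_) (Eventually.of_forall fun N => ?_)
      (g := fun N : ℕ => (N : ℝ)⁻¹ * k₀) ?_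
    · refine mul_nonneg (by positivity) (Finset.sum_nonneg fun k _ => ?_)
      split_ifs <;> norm_num
    · refine mul_le_mul_of_nonneg_left ?_ (by positivity)
      rw [← Finset.sum_filter, Finset.sum_const, nsmul_one]
      have : ((Finset.range N).filter (· < k₀)).card ≤ (Finset.range k₀).card :=
        Finset.card_le_card fun k hk => by simp at hk ⊢; exact hk.2
      rw [Finset.card_range] at this
      exact_mod_cast this
    · simpa using (tendsto_inv_atTop_nhds_zero_nat (𝕜 := ℝ)).mul_const (k₀ : ℝ)
  refine tendsto_order.2 ⟨fun c hc => ?_, fun c hc => ?_⟩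
  · obtain ⟨n, hn⟩ := ((measureReal_superlevel_tendsto_right μ hδ).eventually
      (lt_mem_nhds hc)).exists
    set η : ℝ := 1 / ((n : ℝ) + 1)
    have hη : 0 < η := by positivity
    obtain ⟨k₀, hk₀⟩ := Metric.tendsto_atTop.1 hF η hη
    have hlim := (average_comp_tendsto μ y hy ((continuous_ramp (δ + η) η).comp hG) a).sub (htail k₀)
    have hge : μ.real {t | δ + 2 * η ≤ G t} ≤ ∫ t, max 0 (min 1 ((G t - (δ + η)) / η)) ∂μ := by
      rw [← hind]
      refine integral_mono (hindi _) (hint _ _) fun t => ?_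
      dsimp only
      split_ifs with h
      · have : 1 ≤ (G t - (δ + η)) / η := by rw [le_div_iff₀ hη]; linarith
        rw [min_eq_left this]; exact le_max_right _ _
      · exact le_max_left _ _
    rw [sub_zero] at hlim
    filter_upwards [hlim.eventually (lt_mem_nhds (hn.trans_le hge))] with N hN
    refine hN.trans_le ?_
    rw [← mul_sub, ← Finset.sum_sub_distrib]
    refine mul_le_mul_of_nonneg_left (Finset.sum_le_sum fun k _ => ?_) (by positivity)
    simp only [Function.comp_apply]
    by_cases hk : k < k₀
    · rw [if_pos hk]
      have : max 0 (min 1 ((G (a + k • y) - (δ + η)) / η)) ≤ 1 :=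
        max_le zero_le_one (min_le_left _ _)
      split_ifs <;> linarith
    · rw [if_neg hk, sub_zero]
      have hd := hk₀ k (not_lt.1 hk)
      rw [Real.dist_eq, sub_zero, abs_lt] at hd
      split_ifs with h
      · exact max_le zero_le_one (min_le_left _ _)
      · refine max_le le_rfl ((min_le_right _ _).trans (div_nonpos_of_nonpos_of_nonneg ?_ hη.le))
        linarith
  · obtain ⟨n, hn⟩ := ((measureReal_superlevel_tendsto_left μ hG.measurable δ).eventually
      (gt_mem_nhds hc)).exists
    set η : ℝ := 1 / ((n : ℝ) + 1)
    have hη : 0 < η := by positivity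
    obtain ⟨k₀, hk₀⟩ := Metric.tendsto_atTop.1 hF η hη
    have hlim := (average_comp_tendsto μ y hy ((continuous_ramp (δ - 2 * η) η).comp hG) a).add
      (htail k₀)
    have hge : ∫ t, max 0 (min 1 ((G t - (δ - 2 * η)) / η)) ∂μ ≤ μ.real {t | δ - 2 * η ≤ G t} := by
      rw [← hind]
      refine integral_mono (hint _ _) (hindi _) fun t => ?_
      dsimp only
      split_ifs with h
      · exact max_le zero_le_one (min_le_left _ _)
      · refine max_le le_rfl ((min_le_right _ _).trans (div_nonpos_of_nonpos_of_nonneg ?_ hη.le))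
        linarith
    rw [add_zero] at hlim
    filter_upwards [hlim.eventually (gt_mem_nhds (hge.trans_lt hn))] with N hN
    refine lt_of_le_of_lt ?_ hN
    rw [← mul_add, ← Finset.sum_add_distrib]
    refine mul_le_mul_of_nonneg_left (Finset.sum_le_sum fun k _ => ?_) (by positivity)
    simp only [Function.comp_apply]
    by_cases hk : k < k₀
    · rw [if_pos hk]
      have : 0 ≤ max 0 (min 1 ((G (a + k • y) - (δ - 2 * η)) / η)) := le_max_left _ _
      split_ifs <;> linarith
    · rw [if_neg hk, add_zero]
      have hd := hk₀ k (not_lt.1 hk)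
      rw [Real.dist_eq, sub_zero, abs_lt] at hd
      split_ifs with h
      · have : 1 ≤ (G (a + k • y) - (δ - 2 * η)) / η := by rw [le_div_iff₀ hη]; linarith
        rw [min_eq_left this]; exact le_max_right _ _
      · exact le_max_left _ _

/-- Averages along the residue classes modulo `q` combine to an average over all of `ℕ`. -/
theorem average_tendsto_of_residues {q : ℕ} (hq : 0 < q) {b : ℕ → ℝ} (hb : ∀ n, |b n| ≤ 1)
    {M : ℕ → ℝ} (h : ∀ s < q, Tendsto (fun K : ℕ => (K : ℝ)⁻¹ * ∑ k ∈ Finset.range K, b (s + q * k))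
      atTop (𝓝 (M s))) :
    Tendsto (fun N : ℕ => (N : ℝ)⁻¹ * ∑ n ∈ Finset.range N, b n) atTop
      (𝓝 ((q : ℝ)⁻¹ * ∑ s ∈ Finset.range q, M s)) := by
  have hq' : (0 : ℝ) < q := by exact_mod_cast hq
  have hblock : ∀ K : ℕ, ∑ n ∈ Finset.range (q * K), b n =
      ∑ s ∈ Finset.range q, ∑ k ∈ Finset.range K, b (s + q * k) := by
    intro K
    induction K with
    | zero => simp
    | succ K ih =>
      rw [Nat.mul_succ, Finset.sum_range_add, ih, ← Finset.sum_add_distrib]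
      refine Finset.sum_congr rfl fun s _ => ?_
      rw [Finset.sum_range_succ, add_comm s]
  have hK : Tendsto (fun N : ℕ => N / q) atTop atTop := Nat.tendsto_div_const_atTop hq.ne'
  have hsum : Tendsto (fun K : ℕ => (K : ℝ)⁻¹ * ∑ n ∈ Finset.range (q * K), b n) atTop
      (𝓝 (∑ s ∈ Finset.range q, M s)) := by
    simp only [hblock, Finset.mul_sum]
    refine tendsto_finsetSum _ fun s hs => ?_
    simpa only [Finset.mul_sum] using h s (Finset.mem_range.1 hs)
  have hratio : Tendsto (fun N : ℕ => (N : ℝ)⁻¹ * ((N / q : ℕ) : ℝ)) atTop (𝓝 ((q : ℝ)⁻¹)) := by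
    have h1 : Tendsto (fun N : ℕ => (q : ℝ)⁻¹ - (N : ℝ)⁻¹) atTop (𝓝 ((q : ℝ)⁻¹ - 0)) :=
      (tendsto_inv_atTop_nhds_zero_nat (𝕜 := ℝ)).const_sub _
    rw [sub_zero] at h1
    refine tendsto_of_tendsto_of_tendsto_of_le_of_le' h1 tendsto_const_nhds ?_ ?_
    · filter_upwards [eventually_gt_atTop 0] with N hN
      have hN' : (0 : ℝ) < N := by exact_mod_cast hN
      have h2 : (N : ℝ) ≤ q * ((N / q : ℕ) : ℝ) + q := by
        have := Nat.div_add_mod N q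
        have := Nat.mod_lt N hq
        have : N ≤ q * (N / q) + q := by omega
        exact_mod_cast this
      rw [le_inv_mul_iff₀ hN']
      have : (N : ℝ) * ((q : ℝ)⁻¹ - (N : ℝ)⁻¹) = (N - q) / q := by field_simp
      rw [this, div_le_iff₀ hq']
      linarith
    · filter_upwards [eventually_gt_atTop 0] with N hN
      have hN' : (0 : ℝ) < N := by exact_mod_cast hN
      rw [inv_mul_le_iff₀ hN', ← div_eq_mul_inv]
      exact Nat.cast_div_le
  have hmain : Tendsto (fun N : ℕ => (N : ℝ)⁻¹ * ∑ n ∈ Finset.range (q * (N / q)), b n) atTop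
      (𝓝 ((q : ℝ)⁻¹ * ∑ s ∈ Finset.range q, M s)) := by
    refine (hratio.mul (hsum.comp hK)).congr' ?_
    filter_upwards [hK.eventually (eventually_gt_atTop 0)] with N hN
    have : ((N / q : ℕ) : ℝ) ≠ 0 := by exact_mod_cast (ne_of_gt hN)
    simp only [Function.comp_apply]
    field_simp
  have herr : Tendsto (fun N : ℕ => (N : ℝ)⁻¹ * ∑ n ∈ Finset.range N, b n -
      (N : ℝ)⁻¹ * ∑ n ∈ Finset.range (q * (N / q)), b n) atTop (𝓝 0) := by
    refine squeeze_zero_norm (a := fun N : ℕ => (N : ℝ)⁻¹ * q) (fun N => ?_) ?_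
    · rw [← mul_sub, norm_mul, norm_inv, Real.norm_natCast]
      refine mul_le_mul_of_nonneg_left ?_ (by positivity)
      conv_lhs => rw [← Nat.div_add_mod N q]
      rw [Finset.sum_range_add]
      have hqq : q * ((q * (N / q) + N % q) / q) = q * (N / q) := by rw [Nat.div_add_mod N q]
      rw [hqq, add_sub_cancel_left]
      refine (norm_sum_le_of_le _ fun n _ => hb _).trans ?_
      have := (Nat.mod_lt N hq).le
      simpa using this
    · simpa using (tendsto_inv_atTop_nhds_zero_nat (𝕜 := ℝ)).mul_const (q : ℝ)
  simpa using herr.add hmain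

/-! ### The values of a cosine near the integers -/

theorem half_le_abs_of_sq_add {a b : ℝ} (h : a ^ 2 + b ^ 2 - a * b = 3 / 4 ∨
    a ^ 2 + b ^ 2 + a * b = 3 / 4) (ha : |a| < 2⁻¹) : 2⁻¹ ≤ |b| := by
  by_contra! hb
  rw [abs_lt] at ha hb
  rcases h with h | h <;> nlinarith

theorem sin_sq_add_sin_sq_third (x : ℝ) :
    Real.sin x ^ 2 + Real.sin (x + Real.pi / 3) ^ 2 - Real.sin x * Real.sin (x + Real.pi / 3) =
      3 / 4 := by
  rw [Real.sin_add, Real.cos_pi_div_three, Real.sin_pi_div_three]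
  have h3 : Real.sqrt 3 ^ 2 = 3 := Real.sq_sqrt (by norm_num)
  linear_combination (3 / 4) * Real.sin_sq_add_cos_sq x + (Real.cos x ^ 2 / 4) * h3

/-- At most one of the three numbers `sin (x + i π / 3)` is less than `1 / 2` in modulus. -/
theorem half_le_abs_sin_third {x : ℝ} {i j : Fin 3} (hij : i ≠ j)
    (h : |Real.sin (x + (i : ℕ) * (Real.pi / 3))| < 1 / 2) :
    1 / 2 ≤ |Real.sin (x + (j : ℕ) * (Real.pi / 3))| := by
  have h0 := sin_sq_add_sin_sq_third x
  have h1 := sin_sq_add_sin_sq_third (x + Real.pi / 3)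
  have h2 := sin_sq_add_sin_sq_third (x + 2 * (Real.pi / 3))
  have e1 : x + Real.pi / 3 + Real.pi / 3 = x + 2 * (Real.pi / 3) := by ring
  have e2 : x + 2 * (Real.pi / 3) + Real.pi / 3 = x + Real.pi := by ring
  rw [e1] at h1
  rw [e2, Real.sin_add_pi] at h2
  fin_cases i <;> fin_cases j <;> simp at hij h ⊢ <;>
    refine half_le_abs_of_sq_add ?_ h
  · left; exact h0
  · right; linarith
  · left; linarith
  · left; exact h1
  · right; linarith
  · left; linarith

/-- If the sine is not small near `t + 3φ/2`, then the values of `c + R cos` at two of the points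
`t, t + φ, t + 2φ, t + 3φ` differ by at least `2δ` and at most `3 / 4`, by the choice of `φ`, so
they are not both within `δ` of integers. -/
theorem not_near_int_pair {c R t φ δ : ℝ} (hφ : φ = min (1 / 4) (1 / (4 * R))) (hR : 0 < R)
    (hδ : δ ≤ min 1 R / 64) (hs : 1 / 2 ≤ |Real.sin (t + 3 / 2 * φ)|) {i j : Fin 4} (hij : i < j)
    (hi : ∃ k : ℤ, |c + R * Real.cos (t + (i : ℕ) * φ) - k| < δ)
    (hj : ∃ k : ℤ, |c + R * Real.cos (t + (j : ℕ) * φ) - k| < δ) : False := by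
  obtain ⟨k, hk⟩ := hi
  obtain ⟨l, hl⟩ := hj
  have hφ0 : 0 < φ := by rw [hφ]; positivity
  have hφ1 : φ ≤ 1 / 4 := hφ ▸ min_le_left _ _
  have hφR : R * φ ≤ 1 / 4 := by
    have : φ ≤ 1 / (4 * R) := hφ ▸ min_le_right _ _
    calc R * φ ≤ R * (1 / (4 * R)) := by gcongr
      _ = 1 / 4 := by field_simp
  have hmin : min 1 R / 4 = R * φ := by
    rw [hφ]
    rcases le_total R 1 with h | h
    · rw [min_eq_right h, min_eq_left]
      · ring
      · gcongr; linarith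
    · rw [min_eq_left h, min_eq_right]
      · field_simp
      · gcongr; linarith
  have hδ' : δ ≤ R * φ / 16 := by linarith
  set D : ℝ := (j : ℕ) - (i : ℕ) with hD
  have hij' : (i : ℕ) + 1 ≤ (j : ℕ) := hij
  have hD1 : 1 ≤ D := by
    have : ((i : ℕ) : ℝ) + 1 ≤ (j : ℕ) := by exact_mod_cast hij'
    linarith
  have hj3 : ((j : ℕ) : ℝ) ≤ 3 := by exact_mod_cast (by omega : (j : ℕ) ≤ 3)
  have hi0 : (0 : ℝ) ≤ ((i : ℕ) : ℝ) := by positivity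
  have hD3 : D ≤ 3 := by linarith
  set mid : ℝ := t + ((i : ℕ) + (j : ℕ)) / 2 * φ with hmid
  have hdiff : Real.cos (t + (i : ℕ) * φ) - Real.cos (t + (j : ℕ) * φ) =
      2 * Real.sin mid * Real.sin (D * φ / 2) := by
    rw [Real.cos_sub_cos]
    have e1 : (t + (i : ℕ) * φ + (t + (j : ℕ) * φ)) / 2 = mid := by rw [hmid]; ring
    have e2 : (t + (i : ℕ) * φ - (t + (j : ℕ) * φ)) / 2 = -(D * φ / 2) := by rw [hD]; ring
    rw [e1, e2, Real.sin_neg]; ring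
  have hsinmid : 1 / 4 ≤ |Real.sin mid| := by
    have h1 : |Real.sin (t + 3 / 2 * φ) - Real.sin mid| ≤ |t + 3 / 2 * φ - mid| := by
      have := Real.lipschitzWith_sin.dist_le_mul (t + 3 / 2 * φ) mid
      simpa [Real.dist_eq] using this
    have h2 : |t + 3 / 2 * φ - mid| ≤ 1 / 4 := by
      have h4 : ((i : ℕ) : ℝ) ≤ 2 := by exact_mod_cast (by omega : (i : ℕ) ≤ 2)
      have h5 : t + 3 / 2 * φ - mid = (3 - ((i : ℕ) + (j : ℕ))) / 2 * φ := by rw [hmid]; ring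
      have h6 : |((3 : ℝ) - ((i : ℕ) + (j : ℕ))) / 2| ≤ 1 := by
        rw [abs_le]; constructor <;> linarith
      rw [h5, abs_mul, abs_of_pos hφ0]
      nlinarith
    have h3 := abs_sub_abs_le_abs_sub (Real.sin (t + 3 / 2 * φ)) (Real.sin mid)
    linarith
  have hsD_lo : φ / 4 ≤ Real.sin (D * φ / 2) := by
    have hx0 : 0 ≤ D * φ / 2 := by positivity
    have hpi := Real.pi_gt_three
    have hx1 : D * φ / 2 ≤ Real.pi / 2 := by nlinarith
    have := Real.mul_le_sin hx0 hx1
    refine le_trans ?_ this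
    have h4 : (1 : ℝ) / 2 ≤ 2 / Real.pi := by
      rw [div_le_div_iff₀ (by norm_num) Real.pi_pos]; linarith [Real.pi_le_four]
    nlinarith
  have hsD_hi : Real.sin (D * φ / 2) ≤ 3 / 2 * φ := by
    refine (Real.sin_le (by positivity)).trans ?_
    nlinarith
  have habs : |c + R * Real.cos (t + (i : ℕ) * φ) - (c + R * Real.cos (t + (j : ℕ) * φ))| =
      2 * R * |Real.sin mid| * Real.sin (D * φ / 2) := by
    have e : c + R * Real.cos (t + (i : ℕ) * φ) - (c + R * Real.cos (t + (j : ℕ) * φ)) =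
      R * (2 * Real.sin mid * Real.sin (D * φ / 2)) := by rw [← hdiff]; ring
    rw [e, abs_mul, abs_mul, abs_mul, abs_of_pos hR, abs_of_pos (by norm_num : (0 : ℝ) < 2),
      abs_of_nonneg (le_trans (by positivity) hsD_lo)]
    ring
  set x := c + R * Real.cos (t + (i : ℕ) * φ)
  set y := c + R * Real.cos (t + (j : ℕ) * φ)
  have hlo : R * φ / 8 ≤ |x - y| := by
    rw [habs]
    calc R * φ / 8 = 2 * R * (1 / 4) * (φ / 4) := by ring
      _ ≤ _ := by gcongr
  have hhi : |x - y| ≤ 3 / 4 := by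
    rw [habs]
    calc _ ≤ 2 * R * 1 * (3 / 2 * φ) := by
          gcongr
          · exact le_trans (by positivity) hsD_lo
          · exact Real.abs_sin_le_one _
      _ = 3 * (R * φ) := by ring
      _ ≤ 3 / 4 := by linarith
  have hclose : |(x - y) - ((k - l : ℤ) : ℝ)| < 2 * δ := by
    push_cast
    have e : x - y - ((k : ℝ) - l) = (x - k) - (y - l) := by ring
    rw [e]
    exact (abs_sub _ _).trans_lt (by linarith)
  have hkl : k - l = 0 := by
    have h1 : |((k - l : ℤ) : ℝ)| < 1 := by
      have := abs_sub_abs_le_abs_sub ((k - l : ℤ) : ℝ) (x - y)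
      rw [abs_sub_comm _ (x - y)] at this
      linarith
    rw [← Int.cast_abs] at h1
    exact Int.abs_lt_one_iff.1 (by exact_mod_cast h1)
  rw [hkl, Int.cast_zero, sub_zero] at hclose
  linarith

open Classical in
/-- Of the twelve points `t + i π / 3 + j φ`, at most six give a value of `c + R cos` near an
integer: at most four for the one `i` where the sine may be small, and at most one for each of the
other two. -/
theorem card_near_int_le_six {c R t φ δ : ℝ} (hφ : φ = min (1 / 4) (1 / (4 * R))) (hR : 0 < R)
    (hδ : δ ≤ min 1 R / 64) :
    ∑ p : Fin 3 × Fin 4, (if ∃ k : ℤ,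
      |c + R * Real.cos (t + ((p.1 : ℕ) * (Real.pi / 3) + (p.2 : ℕ) * φ)) - k| < δ then
        (1 : ℝ) else 0) ≤ 6 := by
  rw [Fintype.sum_prod_type]
  dsimp only
  set B : Fin 3 → Fin 4 → Prop := fun a i => ∃ k : ℤ,
      |c + R * Real.cos (t + ((a : ℕ) * (Real.pi / 3) + (i : ℕ) * φ)) - k| < δ with hB
  have hle4 : ∀ a, ∑ i, (if B a i then (1 : ℝ) else 0) ≤ 4 := fun a => by
    refine (Finset.sum_le_card_nsmul _ _ 1 fun i _ => ?_).trans (by simp)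
    split_ifs <;> norm_num
  have hle1 : ∀ a : Fin 3, 1 / 2 ≤ |Real.sin (t + 3 / 2 * φ + (a : ℕ) * (Real.pi / 3))| →
      ∑ i, (if B a i then (1 : ℝ) else 0) ≤ 1 := by
    intro a ha
    rw [← Finset.sum_filter, Finset.sum_const, nsmul_one]
    have : (Finset.univ.filter (B a)).card ≤ 1 := by
      rw [Finset.card_le_one]
      intro i hi j hj
      simp only [Finset.mem_filter, Finset.mem_univ, true_and, hB, ← add_assoc] at hi hj
      by_contra hne
      have hs : 1 / 2 ≤ |Real.sin (t + (a : ℕ) * (Real.pi / 3) + 3 / 2 * φ)| := by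
        rwa [add_right_comm]
      rcases lt_or_gt_of_ne hne with h | h
      · exact not_near_int_pair hφ hR hδ hs h hi hj
      · exact not_near_int_pair hφ hR hδ hs h hj hi
    exact_mod_cast this
  rw [Fin.sum_univ_three]
  by_cases h0 : |Real.sin (t + 3 / 2 * φ + ((0 : Fin 3) : ℕ) * (Real.pi / 3))| < 1 / 2
  · linarith [hle4 0, hle1 1 (half_le_abs_sin_third (by decide) h0),
      hle1 2 (half_le_abs_sin_third (by decide) h0)]
  by_cases h1 : |Real.sin (t + 3 / 2 * φ + ((1 : Fin 3) : ℕ) * (Real.pi / 3))| < 1 / 2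
  · linarith [hle4 1, hle1 0 (not_lt.1 h0), hle1 2 (half_le_abs_sin_third (by decide) h1)]
  · linarith [hle4 2, hle1 0 (not_lt.1 h0), hle1 1 (not_lt.1 h1)]

/-- A set which contains at most half of the translates of each point by a fixed finite family has
measure at most `1 / 2`. -/
theorem measureReal_le_half_of_shifts {T : Type*} [AddCommGroup T] [MeasurableSpace T]
    [MeasurableAdd T] (μ : Measure T) [IsProbabilityMeasure μ] [μ.IsAddLeftInvariant]
    {ι : Type*} [Fintype ι] [Nonempty ι] (y : ι → T) {S : Set T} (hS : MeasurableSet S)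
    [DecidablePred (· ∈ S)]
    (h : ∀ θ, ∑ p, (if y p + θ ∈ S then (1 : ℝ) else 0) ≤ Fintype.card ι / 2) :
    μ.real S ≤ 1 / 2 := by
  have hι : (0 : ℝ) < Fintype.card ι := by exact_mod_cast Fintype.card_pos
  have hind : ∀ p, ∫ θ, (if y p + θ ∈ S then (1 : ℝ) else 0) ∂μ = μ.real S := fun p => by
    rw [integral_add_left_eq_self (fun θ => if θ ∈ S then (1 : ℝ) else 0) (y p),
      ← integral_indicator_one hS]
    refine integral_congr_ae (Eventually.of_forall fun θ => ?_)
    simp [Set.indicator_apply]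
  have hint : ∀ p, Integrable (fun θ => if y p + θ ∈ S then (1 : ℝ) else 0) μ := fun p => by
    refine ((integrable_indicator_iff (measurable_const_add (y p) hS)).2
      (integrable_const (1 : ℝ)).integrableOn).congr (Eventually.of_forall fun θ => ?_)
    by_cases hθ : y p + θ ∈ S <;> simp [Set.indicator, hθ]
  have h1 : ∫ θ, ∑ p, (if y p + θ ∈ S then (1 : ℝ) else 0) ∂μ ≤ ∫ _, (Fintype.card ι / 2 : ℝ) ∂μ :=
    integral_mono (integrable_finsetSum _ fun p _ => hint p) (integrable_const _) h
  rw [integral_finsetSum _ fun p _ => hint p] at h1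
  simp only [hind, Finset.sum_const, Finset.card_univ, nsmul_eq_mul, integral_const,
    probReal_univ, one_smul] at h1
  nlinarith

/-- A function on the torus whose dependence on the coordinate `θ j` is `c + R cos`, where `R =
‖z‖`, is near an integer with probability at most `1 / 2`. The bound on `δ` is uniform in `c` and
for large `R`. -/
theorem measureReal_near_int_le_half {J : Type*} [Fintype J] [DecidableEq J]
    (μ : Measure (UnitAddTorus J)) [IsProbabilityMeasure μ] [μ.IsAddLeftInvariant]
    (j : J) {c : UnitAddTorus J → ℝ} (hc : Continuous c)
    (hcj : ∀ (t : UnitAddCircle) θ, c (Pi.single j t + θ) = c θ) {z : ℂ} (hz : z ≠ 0) {δ : ℝ}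
    (hδ : δ ≤ min 1 ‖z‖ / 64) :
    μ.real {θ | ∃ k : ℤ, |c θ + (z * (AddCircle.toCircle (θ j) : ℂ)).re - k| < δ} ≤ 1 / 2 := by
  classical
  have hR : 0 < ‖z‖ := norm_pos_iff.2 hz
  -- the step is small enough for `c + R cos` to move by at most `3 / 4` over three steps
  set φ : ℝ := min (1 / 4) (1 / (4 * ‖z‖)) with hφ
  have hcont : Continuous fun θ : UnitAddTorus J =>
      c θ + (z * (AddCircle.toCircle (θ j) : ℂ)).re := by
    have := (AddCircle.continuous_toCircle (T := 1)).comp (continuous_apply j :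
      Continuous fun θ : UnitAddTorus J => θ j)
    fun_prop
  have hS : MeasurableSet {θ : UnitAddTorus J |
      ∃ k : ℤ, |c θ + (z * (AddCircle.toCircle (θ j) : ℂ)).re - k| < δ} := by
    have : {θ : UnitAddTorus J |
      ∃ k : ℤ, |c θ + (z * (AddCircle.toCircle (θ j) : ℂ)).re - k| < δ} = ⋃ k : ℤ,
        {θ | |c θ + (z * (AddCircle.toCircle (θ j) : ℂ)).re - k| < δ} := by ext; simp
    rw [this]
    exact (isOpen_iUnion fun k =>
      isOpen_lt (hcont.sub continuous_const).abs continuous_const).measurableSet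
  refine measureReal_le_half_of_shifts μ (ι := Fin 3 × Fin 4)
    (fun p => Pi.single j ((((p.1 : ℕ) * (Real.pi / 3) + (p.2 : ℕ) * φ) / (2 * Real.pi) : ℝ) :
      UnitAddCircle)) hS fun θ => ?_
  have key : ∀ τ : ℝ, (z * (AddCircle.toCircle
      (((τ / (2 * Real.pi) : ℝ) : UnitAddCircle) + θ j) : ℂ)).re =
      ‖z‖ * Real.cos ((z * (AddCircle.toCircle (θ j) : ℂ)).arg + τ) := by
    intro τ
    have h1 := Complex.norm_mul_exp_arg_mul_I (z * (AddCircle.toCircle (θ j) : ℂ))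
    rw [norm_mul, Circle.norm_coe, mul_one] at h1
    have h2 : (AddCircle.toCircle ((τ / (2 * Real.pi) : ℝ) : UnitAddCircle) : ℂ) =
        Complex.exp (τ * Complex.I) := by
      rw [AddCircle.toCircle_apply_mk, Circle.coe_exp]
      congr 2
      have := Real.pi_ne_zero
      push_cast
      field_simp
    rw [AddCircle.toCircle_add, Circle.coe_mul, h2, mul_left_comm]
    conv_lhs => rw [← h1]
    rw [mul_comm, mul_assoc, ← Complex.exp_add, ← add_mul, Complex.re_ofReal_mul, ← Complex.ofReal_add,
      Complex.exp_ofReal_mul_I_re]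
  have hsix := card_near_int_le_six (c := c θ) (t := (z * (AddCircle.toCircle (θ j) : ℂ)).arg)
    hφ hR hδ
  simp only [Set.mem_ofPred_eq, hcj, Pi.add_apply, Pi.single_eq_same, key]
  refine le_trans hsix ?_
  norm_num [Fintype.card_prod]

/-! ### Conjugates of algebraic integers -/

/-- The subfield of `ℂ` generated by the roots of `p`. -/
noncomputable abbrev rootField (p : Polynomial ℚ) : IntermediateField ℚ ℂ :=
  IntermediateField.adjoin ℚ (p.rootSet ℂ)

instance rootField_isSplittingField (p : Polynomial ℚ) : p.IsSplittingField ℚ (rootField p) :=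
  IntermediateField.adjoin_rootSet_isSplittingField (IsAlgClosed.splits _)

instance rootField_normal (p : Polynomial ℚ) : Normal ℚ (rootField p) :=
  Normal.of_isSplittingField p

instance rootField_finiteDimensional (p : Polynomial ℚ) : FiniteDimensional ℚ (rootField p) :=
  Polynomial.IsSplittingField.finiteDimensional _ p

instance rootField_isGalois (p : Polynomial ℚ) : IsGalois ℚ (rootField p) :=
  IsGalois.mk

theorem mem_rootField {p : Polynomial ℚ} (hp : p ≠ 0) {b : ℂ} (hb : Polynomial.aeval b p = 0) :
    b ∈ rootField p :=
  IntermediateField.subset_adjoin _ _ ((Polynomial.mem_rootSet).2 ⟨hp, hb⟩)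

theorem exists_hom_of_roots {p : Polynomial ℚ} (hp : Irreducible p) (hm : p.Monic) {b c : ℂ}
    (hb : Polynomial.aeval b p = 0) (hc : Polynomial.aeval c p = 0) :
    ∃ σ : rootField p →ₐ[ℚ] ℂ, σ ⟨b, mem_rootField hp.ne_zero hb⟩ = c := by
  have hb' : minpoly ℚ (⟨b, mem_rootField hp.ne_zero hb⟩ : rootField p) = p := by
    rw [← minpoly.algebraMap_eq (algebraMap (rootField p) ℂ).injective]
    exact (minpoly.eq_of_irreducible_of_monic hp hb hm).symm
  obtain ⟨σ, hσ⟩ := minpoly.exists_algEquiv_of_root' (K := ℚ) (L := rootField p)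
    (y := ⟨b, mem_rootField hp.ne_zero hb⟩) (x := ⟨c, mem_rootField hp.ne_zero hc⟩)
    (Algebra.IsAlgebraic.isAlgebraic _) (by
      rw [hb']
      apply (algebraMap (rootField p) ℂ).injective
      rw [← Polynomial.aeval_algebraMap_apply, map_zero]
      exact hc)
  refine ⟨(rootField p).val.comp σ.toAlgHom, ?_⟩
  exact congrArg Subtype.val hσ

theorem aeval_hom_root {p : Polynomial ℚ} (hp : p ≠ 0) (σ : rootField p →ₐ[ℚ] ℂ) {b : ℂ}
    (hb : Polynomial.aeval b p = 0) :
    Polynomial.aeval (σ ⟨b, mem_rootField hp hb⟩) p = 0 := by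
  rw [Polynomial.aeval_algHom_apply]
  have : Polynomial.aeval (⟨b, mem_rootField hp hb⟩ : rootField p) p = 0 := by
    apply (algebraMap (rootField p) ℂ).injective
    rw [← Polynomial.aeval_algebraMap_apply, map_zero]
    exact hb
  rw [this, map_zero]

/-- Liouville-type bound: distinct values of an integer polynomial at conjugate algebraic integers
cannot be too close. The product of all conjugates of the difference is a nonzero integer. -/
theorem one_le_norm_sub_mul_pow {p : Polynomial ℤ} (hp : p.Monic) (P : Polynomial ℤ) {b c : ℂ}
    (hb : Polynomial.aeval b p = 0) (hc : Polynomial.aeval c p = 0)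
    (hne : Polynomial.aeval b P ≠ Polynomial.aeval c P) {H : ℝ} (hH : 1 ≤ 2 * H)
    (hbound : ∀ z : ℂ, Polynomial.aeval z p = 0 → ‖Polynomial.aeval z P‖ ≤ H) :
    1 ≤ ‖Polynomial.aeval b P - Polynomial.aeval c P‖ *
      (2 * H) ^ Module.finrank ℚ (rootField (p.map (Int.castRingHom ℚ))) := by
  classical
  set pq := p.map (Int.castRingHom ℚ) with hpq
  have hpq0 : pq ≠ 0 := (hp.map _).ne_zero
  have hcast : ∀ z : ℂ, Polynomial.aeval z pq = Polynomial.aeval z p := fun z => by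
    rw [hpq]; exact Polynomial.aeval_map_algebraMap ℚ z p
  let E := rootField pq
  let b' : E := ⟨b, mem_rootField hpq0 ((hcast b).trans hb)⟩
  let c' : E := ⟨c, mem_rootField hpq0 ((hcast c).trans hc)⟩
  have hval : ∀ (x : E) (Q : Polynomial ℤ), ((Polynomial.aeval x Q : E) : ℂ) =
      Polynomial.aeval (x : ℂ) Q := fun x Q =>
    (Polynomial.aeval_algebraMap_apply ℂ x Q).symm
  let w : E := Polynomial.aeval b' P - Polynomial.aeval c' P
  have hw : (w : ℂ) = Polynomial.aeval b P - Polynomial.aeval c P := by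
    simp only [w, AddSubgroupClass.coe_sub, hval]; rfl
  have hw0 : w ≠ 0 := by
    intro h0
    rw [h0, ZeroMemClass.coe_zero] at hw
    exact hne (sub_eq_zero.1 hw.symm)
  have hint : ∀ x : E, Polynomial.aeval (x : ℂ) p = 0 → IsIntegral ℤ x := fun x hx =>
    ⟨p, hp, by
      apply Subtype.val_injective
      have := hval x p
      rw [hx] at this
      exact this⟩
  have hPint : ∀ (Q : Polynomial ℤ) (x : E), IsIntegral ℤ x → IsIntegral ℤ (Polynomial.aeval x Q) :=
    fun Q x hx =>
      adjoin_le_integralClosure hx (Polynomial.aeval_mem_adjoin_singleton ℤ x)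
  have hwint : IsIntegral ℤ w := (hPint P b' (hint b' hb)).sub (hPint P c' (hint c' hc))
  obtain ⟨m, hm⟩ := IsIntegrallyClosed.isIntegral_iff.1 (Algebra.isIntegral_norm ℚ hwint)
  have hm0 : m ≠ 0 := by
    rintro rfl
    rw [map_zero] at hm
    exact hw0 (Algebra.norm_eq_zero_iff.1 hm.symm)
  have hm1 : (1 : ℝ) ≤ ‖((Algebra.norm ℚ w : ℚ) : ℂ)‖ := by
    rw [← hm]
    have : (1 : ℝ) ≤ |(m : ℝ)| := by exact_mod_cast Int.one_le_abs hm0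
    simpa using this
  have hprod : ((Algebra.norm ℚ w : ℚ) : ℂ) = ∏ σ : E ≃ₐ[ℚ] E, ((σ w : E) : ℂ) := by
    have h1 := congrArg (algebraMap E ℂ) (Algebra.norm_eq_prod_automorphisms ℚ w)
    rw [map_prod] at h1
    rw [← IsScalarTower.algebraMap_apply] at h1
    exact h1
  have hfac : ∀ σ : E ≃ₐ[ℚ] E, ‖((σ w : E) : ℂ)‖ ≤ 2 * H := by
    intro σ
    have hroot : ∀ x : E, Polynomial.aeval (x : ℂ) p = 0 →
        ‖((σ (Polynomial.aeval x P) : E) : ℂ)‖ ≤ H := by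
      intro x hx
      have h1 : σ (Polynomial.aeval x P) = Polynomial.aeval (σ x) P :=
        (Polynomial.aeval_algHom_apply (σ.toAlgHom.restrictScalars ℤ) x P).symm
      rw [h1, hval]
      refine hbound _ ?_
      rw [← hval]
      have h2 : Polynomial.aeval (σ x) p = σ (Polynomial.aeval x p) :=
        Polynomial.aeval_algHom_apply (σ.toAlgHom.restrictScalars ℤ) x p
      have h3 : Polynomial.aeval x p = 0 := by
        apply Subtype.val_injective
        rw [hval, hx]; rfl
      rw [h2, h3, map_zero]; rfl
    have h4 : σ w = σ (Polynomial.aeval b' P) - σ (Polynomial.aeval c' P) := map_sub σ _ _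
    rw [h4, AddSubgroupClass.coe_sub]
    refine (norm_sub_le _ _).trans ?_
    linarith [hroot b' hb, hroot c' hc]
  rw [hprod, norm_prod, ← Finset.mul_prod_erase _ _ (Finset.mem_univ (1 : E ≃ₐ[ℚ] E))] at hm1
  have h1w : (((1 : E ≃ₐ[ℚ] E) w : E) : ℂ) = Polynomial.aeval b P - Polynomial.aeval c P := hw
  rw [h1w] at hm1
  refine hm1.trans (mul_le_mul_of_nonneg_left ?_ (norm_nonneg _))
  refine (Finset.prod_le_prod (fun _ _ => norm_nonneg _) fun σ _ => hfac σ).trans ?_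
  rw [Finset.prod_const]
  refine pow_le_pow_right₀ hH ?_
  refine (Finset.card_le_univ _).trans ?_
  rw [← Nat.card_eq_fintype_card, IsGalois.card_aut_eq_finrank]

/-! ### The conjugates of a Salem number -/

/-- The complex conjugates of the real number `α`. -/
noncomputable def conjugates (α : ℝ) : Finset ℂ :=
  ((minpoly ℚ α).aroots ℂ).toFinset

open Classical in
/-- The conjugates of `α` on the open upper half of the unit circle. -/
noncomputable def upperConjugates (α : ℝ) : Finset ℂ :=
  (conjugates α).filter fun z => ‖z‖ = 1 ∧ 0 < z.im

namespace IsSalemNumber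

variable {α : ℝ}

theorem minpoly_ne_zero (h : IsSalemNumber α) : minpoly ℚ α ≠ 0 := minpoly.ne_zero h.isIntegral_rat

theorem mem_conjugates (h : IsSalemNumber α) {z : ℂ} :
    z ∈ conjugates α ↔ Polynomial.aeval z (minpoly ℚ α) = 0 := by
  rw [conjugates, Multiset.mem_toFinset, Polynomial.mem_aroots]
  exact and_iff_right h.minpoly_ne_zero

theorem self_mem_conjugates (h : IsSalemNumber α) : (α : ℂ) ∈ conjugates α := by
  rw [h.mem_conjugates]
  have := Polynomial.aeval_algebraMap_apply ℂ α (minpoly ℚ α)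
  rw [minpoly.aeval, map_zero] at this
  exact this

theorem inv_self_mem_conjugates (h : IsSalemNumber α) : (α : ℂ)⁻¹ ∈ conjugates α := by
  rw [conjugates, Multiset.mem_toFinset]
  exact h.inv_mem_aroots

theorem conj_mem_conjugates (h : IsSalemNumber α) {z : ℂ} (hz : z ∈ conjugates α) :
    (starRingEnd ℂ) z ∈ conjugates α := by
  rw [h.mem_conjugates] at hz ⊢
  have h2 := Polynomial.aeval_algHom_apply (Complex.conjAe.toAlgHom.restrictScalars ℚ) z
    (minpoly ℚ α)
  rw [hz, map_zero] at h2
  exact h2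

theorem exists_hom (h : IsSalemNumber α) {b c : ℂ} (hb : b ∈ conjugates α)
    (hc : c ∈ conjugates α) :
    ∃ σ : rootField (minpoly ℚ α) →ₐ[ℚ] ℂ,
      σ ⟨b, mem_rootField h.minpoly_ne_zero (h.mem_conjugates.1 hb)⟩ = c :=
  exists_hom_of_roots (minpoly.irreducible h.isIntegral_rat) (minpoly.monic h.isIntegral_rat)
    (h.mem_conjugates.1 hb) (h.mem_conjugates.1 hc)

theorem hom_mem_conjugates (h : IsSalemNumber α) (σ : rootField (minpoly ℚ α) →ₐ[ℚ] ℂ) {b : ℂ}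
    (hb : b ∈ conjugates α) :
    σ ⟨b, mem_rootField h.minpoly_ne_zero (h.mem_conjugates.1 hb)⟩ ∈ conjugates α :=
  h.mem_conjugates.2 (aeval_hom_root h.minpoly_ne_zero σ (h.mem_conjugates.1 hb))

theorem inv_mem_conjugates (h : IsSalemNumber α) {z : ℂ} (hz : z ∈ conjugates α) :
    z⁻¹ ∈ conjugates α := by
  obtain ⟨σ, hσ⟩ := h.exists_hom h.self_mem_conjugates hz
  have h1 := h.hom_mem_conjugates σ h.inv_self_mem_conjugates
  have h2 : (⟨(α : ℂ)⁻¹, mem_rootField h.minpoly_ne_zero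
      (h.mem_conjugates.1 h.inv_self_mem_conjugates)⟩ : rootField (minpoly ℚ α)) =
      (⟨(α : ℂ), mem_rootField h.minpoly_ne_zero
      (h.mem_conjugates.1 h.self_mem_conjugates)⟩)⁻¹ := rfl
  rwa [h2, map_inv₀, hσ] at h1

/-- The conjugates are closed under inversion, so both `‖z‖` and `‖z⁻¹‖` are at most `1`. -/
theorem norm_eq_one (h : IsSalemNumber α) {z : ℂ} (hz : z ∈ conjugates α) (h1 : z ≠ α)
    (h2 : z ≠ (α : ℂ)⁻¹) :
    ‖z‖ = 1 := by
  have hz' : z⁻¹ ≠ α := fun h0 => h2 (by rw [← h0, inv_inv])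
  have hle : ∀ w ∈ conjugates α, w ≠ (α : ℂ) → ‖w‖ ≤ 1 := fun w hw =>
    h.norm_le_one w (Multiset.mem_toFinset.1 hw)
  refine le_antisymm (hle z hz h1) ?_
  have h3 := hle _ (h.inv_mem_conjugates hz) hz'
  rw [norm_inv] at h3
  have hz0 : z ≠ 0 := by
    rintro rfl
    obtain ⟨σ, hσ⟩ := h.exists_hom hz h.self_mem_conjugates
    have h4 : (⟨0, mem_rootField h.minpoly_ne_zero (h.mem_conjugates.1 hz)⟩ :
      rootField (minpoly ℚ α)) = 0 := rfl
    rw [h4, map_zero] at hσ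
    exact (zero_lt_one.trans h.one_lt).ne (by exact_mod_cast hσ)
  exact (inv_le_one₀ (norm_pos_iff.2 hz0)).1 h3

/-- A real conjugate on the unit circle would satisfy `z² = 1`, and then so would `α`. -/
theorem im_ne_zero (h : IsSalemNumber α) {z : ℂ} (hz : z ∈ conjugates α) (h1 : ‖z‖ = 1) :
    z.im ≠ 0 := by
  intro him
  have hsq : z * z = 1 := by
    have h2 : Complex.normSq z = 1 := by rw [Complex.normSq_eq_norm_sq, h1, one_pow]
    rw [Complex.normSq_apply, him] at h2
    apply Complex.ext <;> simp [him]
    linarith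
  obtain ⟨σ, hσ⟩ := h.exists_hom hz h.self_mem_conjugates
  have h3 : (⟨z, mem_rootField h.minpoly_ne_zero (h.mem_conjugates.1 hz)⟩ :
      rootField (minpoly ℚ α)) * ⟨z, mem_rootField h.minpoly_ne_zero (h.mem_conjugates.1 hz)⟩ = 1 :=
    Subtype.ext hsq
  have h4 := congrArg σ h3
  rw [map_mul, hσ, map_one] at h4
  have h5 : α * α = 1 := by exact_mod_cast h4
  nlinarith [h.one_lt]

theorem inv_eq_conj {z : ℂ} (h1 : ‖z‖ = 1) : z⁻¹ = (starRingEnd ℂ) z := by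
  rw [Complex.inv_def, Complex.normSq_eq_norm_sq, h1]; simp

theorem mem_upperConjugates {z : ℂ} :
    z ∈ upperConjugates α ↔ z ∈ conjugates α ∧ ‖z‖ = 1 ∧ 0 < z.im := by
  rw [upperConjugates, Finset.mem_filter]

theorem upper_or_conj_upper (h : IsSalemNumber α) {z : ℂ} (hz : z ∈ conjugates α) (h1 : ‖z‖ = 1) :
    z ∈ upperConjugates α ∨ (starRingEnd ℂ) z ∈ upperConjugates α := by
  rcases lt_or_gt_of_ne (h.im_ne_zero hz h1) with him | him
  · exact Or.inr (mem_upperConjugates.2 ⟨h.conj_mem_conjugates hz, by simpa using h1,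
      by simpa using him⟩)
  · exact Or.inl (mem_upperConjugates.2 ⟨hz, h1, him⟩)

theorem upperConjugates_nonempty (h : IsSalemNumber α) : (upperConjugates α).Nonempty := by
  obtain ⟨z, hz, h1⟩ := h.exists_norm_eq_one
  rcases h.upper_or_conj_upper (Multiset.mem_toFinset.2 hz) h1 with hu | hu
  exacts [⟨_, hu⟩, ⟨_, hu⟩]

/-- The conjugates on the upper half circle are multiplicatively independent: an embedding sending
one of them to `α` sends all the others to the unit circle. -/
theorem eq_zero_of_prod_zpow_eq_one (h : IsSalemNumber α) (n : upperConjugates α → ℤ)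
    (hn : ∏ z : upperConjugates α, (z : ℂ) ^ n z = 1) : n = 0 := by
  funext j
  have hmem : ∀ i : upperConjugates α, (i : ℂ) ∈ conjugates α := fun i =>
    (mem_upperConjugates.1 i.2).1
  let lift : upperConjugates α → rootField (minpoly ℚ α) := fun i =>
    ⟨i, mem_rootField h.minpoly_ne_zero (h.mem_conjugates.1 (hmem i))⟩
  obtain ⟨σ, hσ⟩ := h.exists_hom (hmem j) h.self_mem_conjugates
  change σ (lift j) = α at hσ
  have hlift : ∏ i, lift i ^ n i = 1 := by
    apply (algebraMap (rootField (minpoly ℚ α)) ℂ).injective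
    rw [map_prod, map_one, ← hn]
    exact Finset.prod_congr rfl fun i _ => map_zpow₀ _ _ _
  have h1 := congrArg (fun x => ‖σ x‖) hlift
  simp only [map_prod, map_zpow₀, map_one, norm_prod, norm_zpow, norm_one] at h1
  rw [Fintype.prod_eq_single j] at h1
  · rw [hσ, Complex.norm_real, Real.norm_of_nonneg (zero_lt_one.trans h.one_lt).le] at h1
    exact (zpow_eq_one_iff_right₀ (zero_lt_one.trans h.one_lt).le h.one_lt.ne').1 h1
  · intro i hij
    have hi1 : σ (lift i) ≠ α := fun h0 => hij (by
      have := σ.injective (h0.trans hσ.symm)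
      exact Subtype.ext (congrArg (fun x : rootField (minpoly ℚ α) => (x : ℂ)) this))
    have hi2 : σ (lift i) ≠ (α : ℂ)⁻¹ := fun h0 => by
      rw [← hσ, ← map_inv₀] at h0
      have h3 : (i : ℂ) = (j : ℂ)⁻¹ := congrArg Subtype.val (σ.injective h0)
      have hj := (mem_upperConjugates.1 j.2).2
      have hi := (mem_upperConjugates.1 i.2).2
      rw [inv_eq_conj hj.1] at h3
      have := congrArg Complex.im h3
      rw [Complex.conj_im] at this
      linarith [hj.2, hi.2]
    rw [h.norm_eq_one (h.hom_mem_conjugates σ (hmem i)) hi1 hi2, one_zpow]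

theorem conj_aeval (P : Polynomial ℤ) (z : ℂ) :
    (starRingEnd ℂ) (Polynomial.aeval z P) = Polynomial.aeval ((starRingEnd ℂ) z) P :=
  (Polynomial.aeval_algHom_apply (Complex.conjAe.toAlgHom.restrictScalars ℤ) z P).symm

theorem aeval_ofReal (P : Polynomial ℤ) (x : ℝ) :
    Polynomial.aeval (x : ℂ) P = ((Polynomial.aeval x P : ℝ) : ℂ) :=
  Polynomial.aeval_algebraMap_apply ℂ x P

theorem card_conjugates (h : IsSalemNumber α) : (conjugates α).card = (minpoly ℚ α).natDegree := by
  rw [conjugates, Multiset.toFinset_card_of_nodup]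
  · rw [← Polynomial.natDegree_map (algebraMap ℚ ℂ)]
    exact (IsAlgClosed.splits _).natDegree_eq_card_roots.symm
  · exact Polynomial.nodup_aroots_iff_of_splits h.minpoly_ne_zero (IsAlgClosed.splits _) |>.2
      (minpoly.irreducible h.isIntegral_rat).separable

/-- If a polynomial of degree less than that of `α` takes the same value at `α` and at all its
conjugates on the unit circle, then it is constant. -/
theorem eq_C_of_aeval_eq (h : IsSalemNumber α) {P : Polynomial ℤ}
    (hdeg : P.natDegree < (minpoly ℚ α).natDegree)
    (hP : ∀ z ∈ upperConjugates α, Polynomial.aeval z P = Polynomial.aeval (α : ℂ) P) :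
    P = Polynomial.C (P.coeff 0) := by
  set c := Polynomial.aeval (α : ℂ) P with hc
  have hcirc : ∀ z ∈ conjugates α, ‖z‖ = 1 → Polynomial.aeval z P = c := by
    intro z hz h1
    rcases h.upper_or_conj_upper hz h1 with hu | hu
    · exact hP z hu
    · have h2 := hP _ hu
      rw [← conj_aeval] at h2
      have h3 := congrArg (starRingEnd ℂ) h2
      rw [Complex.conj_conj] at h3
      rw [h3, hc, aeval_ofReal, Complex.conj_ofReal]
  obtain ⟨b, hb⟩ := h.upperConjugates_nonempty
  obtain ⟨hbc, hb1, hbim⟩ := mem_upperConjugates.1 hb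
  have hinv : Polynomial.aeval ((α : ℂ)⁻¹) P = c := by
    obtain ⟨σ, hσ⟩ := h.exists_hom hbc h.self_mem_conjugates
    set b' : rootField (minpoly ℚ α) :=
      ⟨b, mem_rootField h.minpoly_ne_zero (h.mem_conjugates.1 hbc)⟩
    have hval : ∀ x : rootField (minpoly ℚ α), ((Polynomial.aeval x P : rootField _) : ℂ) =
      Polynomial.aeval (x : ℂ) P := fun x => (Polynomial.aeval_algebraMap_apply ℂ x P).symm
    have hσP : ∀ x, σ (Polynomial.aeval x P) = Polynomial.aeval (σ x) P := fun x =>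
      (Polynomial.aeval_algHom_apply (σ.restrictScalars ℤ) x P).symm
    have h1 : Polynomial.aeval b' P = Polynomial.aeval b'⁻¹ P := by
      apply Subtype.val_injective
      rw [hval, hval]
      have h2 : ((b'⁻¹ : rootField (minpoly ℚ α)) : ℂ) = b⁻¹ := rfl
      rw [h2, hcirc b hbc hb1, hcirc b⁻¹ (h.inv_mem_conjugates hbc) (by rw [norm_inv, hb1, inv_one])]
    have h3 := congrArg σ h1
    rw [hσP, hσP, map_inv₀, hσ] at h3
    exact h3.symm
  have hall : ∀ z ∈ conjugates α, Polynomial.aeval z P = c := by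
    intro z hz
    by_cases h1 : z = α
    · rw [h1]
    by_cases h2 : z = (α : ℂ)⁻¹
    · rw [h2, hinv]
    exact hcirc z hz (h.norm_eq_one hz h1 h2)
  have hpos : 0 < (minpoly ℚ α).natDegree := minpoly.natDegree_pos h.isIntegral_rat
  have hmap : P.map (algebraMap ℤ ℂ) = Polynomial.C c := by
    refine Polynomial.eq_of_degrees_lt_of_eval_finset_eq (conjugates α) ?_ ?_ fun z hz => ?_
    · rw [h.card_conjugates]
      refine (Polynomial.degree_map_le).trans_lt ?_
      exact (Polynomial.degree_le_natDegree).trans_lt (by exact_mod_cast hdeg)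
    · rw [h.card_conjugates]
      exact Polynomial.degree_C_le.trans_lt (by exact_mod_cast hpos)
    · rw [Polynomial.eval_C, Polynomial.eval_map_algebraMap, hall z hz]
  refine Polynomial.eq_C_of_natDegree_eq_zero ?_
  rw [← Polynomial.natDegree_map_eq_of_injective (algebraMap ℤ ℂ).injective_int, hmap,
    Polynomial.natDegree_C]

end IsSalemNumber

/-! ### The eigenvector decomposition -/

open Matrix in
/-- The component of the vector `𝟏` in the eigenspace of `A` for the eigenvalue `b`, as the image
of `𝟏` under the Lagrange basis polynomial of `b`, evaluated at `A`. -/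
noncomputable def eigenComponent {d : ℕ} (A : Matrix (Fin d) (Fin d) ℤ) (α : ℝ) (b : ℂ) :
    Fin d → ℂ :=
  Polynomial.aeval (A.map (algebraMap ℤ ℂ)) (Lagrange.basis (conjugates α) id b) *ᵥ 1

section Eigen

open Matrix

variable {d : ℕ} {A : Matrix (Fin d) (Fin d) ℤ} {α : ℝ}

namespace IsSalemNumber

theorem degree_eq (hA : A.charpoly.map (Int.castRingHom ℚ) = minpoly ℚ α) :
    (minpoly ℚ α).natDegree = d := by
  rw [← hA, (charpoly_monic A).natDegree_map, charpoly_natDegree_eq_dim, Fintype.card_fin]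

theorem aeval_charpoly (hA : A.charpoly.map (Int.castRingHom ℚ) = minpoly ℚ α) (z : ℂ) :
    Polynomial.aeval z A.charpoly = Polynomial.aeval z (minpoly ℚ α) := by
  rw [← hA]; exact (Polynomial.aeval_map_algebraMap ℚ z _).symm

/-- The eigenvalues of `A` are simple, so a polynomial that vanishes at all of them kills `A`. -/
theorem aeval_matrix_eq_zero (h : IsSalemNumber α)
    (hA : A.charpoly.map (Int.castRingHom ℚ) = minpoly ℚ α) {g : Polynomial ℂ}
    (hg : ∀ b ∈ conjugates α, g.eval b = 0) :
    Polynomial.aeval (A.map (algebraMap ℤ ℂ)) g = 0 := by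
  set p := (A.map (algebraMap ℤ ℂ)).charpoly with hp
  have hpm : p.Monic := charpoly_monic _
  have hpA : p = A.charpoly.map (algebraMap ℤ ℂ) := charpoly_map A (algebraMap ℤ ℂ)
  have hr : g %ₘ p = 0 := by
    refine Polynomial.eq_zero_of_degree_lt_of_eval_finset_eq_zero (conjugates α) ?_ fun b hb => ?_
    · rw [h.card_conjugates, degree_eq hA]
      have h1 := Polynomial.degree_modByMonic_lt g hpm
      rwa [hp, charpoly_degree_eq_dim, Fintype.card_fin] at h1
    · have hpb : p.eval b = 0 := by
        rw [hpA, Polynomial.eval_map_algebraMap, aeval_charpoly hA, h.mem_conjugates.1 hb]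
      have h1 := congrArg (Polynomial.eval b) (Polynomial.modByMonic_add_div g p)
      rwa [Polynomial.eval_add, Polynomial.eval_mul, hpb, zero_mul, add_zero, hg b hb] at h1
  have h2 := Polynomial.modByMonic_add_div g p
  rw [hr, zero_add] at h2
  rw [← h2, map_mul, hp, aeval_self_charpoly, zero_mul]

theorem eval_basis (b c : ℂ) (hb : b ∈ conjugates α) (hc : c ∈ conjugates α) :
    (Lagrange.basis (conjugates α) id b).eval c = if b = c then 1 else 0 := by
  split_ifs with hbc
  · subst hbc
    exact Lagrange.eval_basis_self (v := id) Function.injective_id.injOn hb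
  · exact Lagrange.eval_basis_of_ne (v := id) hbc hc

theorem sum_eigenComponent (h : IsSalemNumber α) :
    ∑ b ∈ conjugates α, eigenComponent A α b = 1 := by
  simp only [eigenComponent]
  rw [← sum_mulVec, ← map_sum, Lagrange.sum_basis Function.injective_id.injOn
    ⟨_, h.self_mem_conjugates⟩, map_one, one_mulVec]

theorem aeval_mulVec_eigenComponent (h : IsSalemNumber α)
    (hA : A.charpoly.map (Int.castRingHom ℚ) = minpoly ℚ α) (g : Polynomial ℂ) {b : ℂ}
    (hb : b ∈ conjugates α) :
    Polynomial.aeval (A.map (algebraMap ℤ ℂ)) g *ᵥ eigenComponent A α b =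
      g.eval b • eigenComponent A α b := by
  -- the polynomial `(g - g(b)) ℓ_b` vanishes at all eigenvalues
  have h1 := h.aeval_matrix_eq_zero hA
    (g := (g - Polynomial.C (g.eval b)) * Lagrange.basis (conjugates α) id b) fun c hc => by
      rw [Polynomial.eval_mul, eval_basis b c hb hc]
      split_ifs with hbc
      · subst hbc; simp
      · simp
  rw [map_mul, map_sub, Polynomial.aeval_C, sub_mul, sub_eq_zero] at h1
  rw [eigenComponent, mulVec_mulVec, h1, Algebra.algebraMap_eq_smul_one, smul_mul_assoc, one_mul,
    smul_mulVec]

theorem aeval_mulVec_one (h : IsSalemNumber α)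
    (hA : A.charpoly.map (Int.castRingHom ℚ) = minpoly ℚ α) (g : Polynomial ℂ) :
    Polynomial.aeval (A.map (algebraMap ℤ ℂ)) g *ᵥ 1 =
      ∑ b ∈ conjugates α, g.eval b • eigenComponent A α b := by
  rw [← h.sum_eigenComponent (A := A), mulVec_sum]
  exact Finset.sum_congr rfl fun b hb => h.aeval_mulVec_eigenComponent hA g hb

theorem eigenComponent_conj (h : IsSalemNumber α)
    (hA : A.charpoly.map (Int.castRingHom ℚ) = minpoly ℚ α) {b : ℂ} (hb : b ∈ conjugates α)
    (i : Fin d) :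
    eigenComponent A α ((starRingEnd ℂ) b) i = (starRingEnd ℂ) (eigenComponent A α b i) := by
  set Q := Lagrange.basis (conjugates α) id b
  have h1 := h.aeval_matrix_eq_zero hA
    (g := Lagrange.basis (conjugates α) id ((starRingEnd ℂ) b) - Q.map (starRingEnd ℂ))
    fun c hc => by
      have h2 : (Q.map (starRingEnd ℂ)).eval c = (starRingEnd ℂ) (Q.eval ((starRingEnd ℂ) c)) := by
        conv_lhs => rw [← Complex.conj_conj c]
        rw [Polynomial.eval_map_apply]
      rw [Polynomial.eval_sub, h2, eval_basis _ c (h.conj_mem_conjugates hb) hc,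
        eval_basis b _ hb (h.conj_mem_conjugates hc)]
      have h3 : (starRingEnd ℂ) b = c ↔ b = (starRingEnd ℂ) c :=
        ⟨fun h0 => by rw [← h0, Complex.conj_conj], fun h0 => by rw [h0, Complex.conj_conj]⟩
      simp only [h3]
      split_ifs <;> simp
  rw [map_sub, sub_eq_zero] at h1
  have h4 : Polynomial.aeval (A.map (algebraMap ℤ ℂ)) (Q.map (starRingEnd ℂ)) =
      (Polynomial.aeval (A.map (algebraMap ℤ ℂ)) Q).map (starRingEnd ℂ) := by
    have h5 := Polynomial.hom_eval₂ Q (algebraMap ℂ (Matrix (Fin d) (Fin d) ℂ))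
      (RingHom.mapMatrix (starRingEnd ℂ)) (A.map (algebraMap ℤ ℂ))
    have h6 : (RingHom.mapMatrix (starRingEnd ℂ)) (A.map (algebraMap ℤ ℂ)) =
        A.map (algebraMap ℤ ℂ) := by
      ext i j; simp
    have h7 : (RingHom.mapMatrix (starRingEnd ℂ)).comp (algebraMap ℂ (Matrix (Fin d) (Fin d) ℂ)) =
        (algebraMap ℂ (Matrix (Fin d) (Fin d) ℂ)).comp (starRingEnd ℂ) := by
      ext z i j
      by_cases hij : i = j <;> simp [algebraMap_matrix_apply, hij]
    rw [h6, h7] at h5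
    rw [Polynomial.aeval_def, Polynomial.eval₂_map, ← h5]
    rfl
  rw [eigenComponent, eigenComponent, h1, h4]
  simp [mulVec, dotProduct, map_sum]
  rfl

theorem aeval_int_matrix (P : Polynomial ℤ) :
    Polynomial.aeval (A.map (algebraMap ℤ ℂ)) (P.map (algebraMap ℤ ℂ)) =
      (Polynomial.aeval A P).map (algebraMap ℤ ℂ) := by
  have h5 := Polynomial.hom_eval₂ P (algebraMap ℤ (Matrix (Fin d) (Fin d) ℤ))
    (RingHom.mapMatrix (algebraMap ℤ ℂ)) A
  rw [Polynomial.aeval_map_algebraMap]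
  rw [RingHom.mapMatrix_apply] at h5
  rw [Polynomial.aeval_def, Polynomial.aeval_def, h5]
  congr 1
  exact RingHom.ext_int _ _

theorem map_mulVec_one (B : Matrix (Fin d) (Fin d) ℤ) (i : Fin d) :
    (B.map (algebraMap ℤ ℂ) *ᵥ 1) i = (((B *ᵥ 1) i : ℤ) : ℂ) := by
  simp [mulVec, dotProduct]

/-- If `eigenComponent A α b` vanished, then `𝟏, A 𝟏, …, A^(d-1) 𝟏` would be linearly dependent,
hence `𝟏` would be killed by a nonzero integer polynomial in `A` of degree less than `d`. -/
theorem eigenComponent_ne_zero (h : IsSalemNumber α)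
    (hA : A.charpoly.map (Int.castRingHom ℚ) = minpoly ℚ α) {b : ℂ} (hb : b ∈ conjugates α) :
    eigenComponent A α b ≠ 0 := by
  intro hv
  have hd : 0 < d := degree_eq hA ▸ minpoly.natDegree_pos h.isIntegral_rat
  obtain ⟨c₀, hc₀, hvc₀⟩ : ∃ c ∈ conjugates α, eigenComponent A α c ≠ 0 := by
    by_contra! hall
    have h1 := h.sum_eigenComponent (A := A)
    rw [Finset.sum_eq_zero hall] at h1
    exact zero_ne_one (congrFun h1 ⟨0, hd⟩)
  -- no nonzero integer polynomial of degree less than `d` kills `𝟏`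
  have hkill : ∀ f : Polynomial ℤ, f.natDegree < d → Polynomial.aeval A f *ᵥ 1 = 0 → f = 0 := by
    intro f hf hf0
    have h1 := h.aeval_mulVec_one hA (f.map (algebraMap ℤ ℂ))
    have h2 : Polynomial.aeval (A.map (algebraMap ℤ ℂ)) (f.map (algebraMap ℤ ℂ)) *ᵥ 1 = 0 := by
      funext i
      rw [aeval_int_matrix, map_mulVec_one, hf0]; simp
    rw [h2] at h1
    have h3 := congrArg (fun v => Polynomial.aeval (A.map (algebraMap ℤ ℂ))
      (Lagrange.basis (conjugates α) id c₀) *ᵥ v) h1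
    simp only [mulVec_zero, mulVec_sum, mulVec_smul] at h3
    rw [Finset.sum_eq_single_of_mem c₀ hc₀, h.aeval_mulVec_eigenComponent hA _ hc₀,
      eval_basis _ _ hc₀ hc₀, if_pos rfl, one_smul] at h3
    · have h4 := (smul_eq_zero.1 h3.symm).resolve_right hvc₀
      rw [Polynomial.eval_map_algebraMap, ← Polynomial.aeval_map_algebraMap ℚ] at h4
      have h5 : minpoly ℚ α = minpoly ℚ c₀ := minpoly.eq_of_irreducible_of_monic
        (minpoly.irreducible h.isIntegral_rat) (h.mem_conjugates.1 hc₀)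
        (minpoly.monic h.isIntegral_rat)
      have h6 := minpoly.dvd ℚ c₀ h4
      rw [← h5] at h6
      by_contra hne
      have h7 : f.map (algebraMap ℤ ℚ) ≠ 0 :=
        (Polynomial.map_ne_zero_iff (algebraMap ℤ ℚ).injective_int).2 hne
      have h8 := Polynomial.natDegree_le_of_dvd h6 h7
      rw [degree_eq hA, Polynomial.natDegree_map_eq_of_injective (algebraMap ℤ ℚ).injective_int] at h8
      omega
    · intro c hc hcc
      rw [h.aeval_mulVec_eigenComponent hA _ hc, eval_basis _ _ hc₀ hc, if_neg hcc.symm, zero_smul,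
        smul_zero]
  -- so the Krylov matrix is invertible
  let K : Matrix (Fin d) (Fin d) ℤ := Matrix.of fun i k => (A ^ (k : ℕ) *ᵥ 1) i
  have hK : K.det ≠ 0 := by
    intro hdet
    obtain ⟨c, hc0, hc⟩ := exists_mulVec_eq_zero_iff.2 hdet
    let f : Polynomial ℤ := ∑ k : Fin d, Polynomial.C (c k) * Polynomial.X ^ (k : ℕ)
    have hcoeff : ∀ k : Fin d, f.coeff k = c k := fun k => by
      simp only [f, Polynomial.finsetSum_coeff, Polynomial.coeff_C_mul_X_pow]
      rw [Finset.sum_eq_single_of_mem k (Finset.mem_univ _)]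
      · simp
      · intro j _ hj
        rw [if_neg]
        exact fun h0 => hj (Fin.ext h0.symm)
    have hdeg : f.natDegree < d := by
      refine lt_of_le_of_lt (Polynomial.natDegree_sum_le_of_forall_le (n := d - 1) _ _
        fun k _ => ?_) (by omega)
      refine (Polynomial.natDegree_C_mul_X_pow_le _ _).trans ?_
      have := k.2
      omega
    have hf0 : f = 0 := by
      refine hkill f hdeg ?_
      funext i
      refine Eq.trans ?_ (congrFun hc i)
      simp only [f, map_sum, map_mul, Polynomial.aeval_C, map_pow, Polynomial.aeval_X, sum_mulVec,
        Algebra.algebraMap_eq_smul_one, smul_mul_assoc, one_mul, smul_mulVec, Finset.sum_apply,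
        Pi.smul_apply, smul_eq_mul]
      simp only [mulVec, dotProduct, K, of_apply]
      exact Finset.sum_congr rfl fun k _ => mul_comm _ _
    apply hc0
    funext k
    rw [← hcoeff, hf0]; simp
  set Q := Lagrange.basis (conjugates α) id b with hQ
  have hQdeg : Q.natDegree < d := by
    rw [hQ, Lagrange.natDegree_basis Function.injective_id.injOn hb, h.card_conjugates,
      degree_eq hA]
    omega
  have hQ0 : (fun k : Fin d => Q.coeff k) = 0 := by
    by_contra hne
    have h1 : K.map (algebraMap ℤ ℂ) *ᵥ (fun k : Fin d => Q.coeff k) = 0 := by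
      funext i
      have h2 := congrFun hv i
      rw [eigenComponent, Polynomial.aeval_eq_sum_range' hQdeg, Finset.sum_range, sum_mulVec,
        Finset.sum_apply] at h2
      rw [← h2]
      change ∑ k : Fin d, K.map (algebraMap ℤ ℂ) i k * Q.coeff k = _
      refine Finset.sum_congr rfl fun k _ => ?_
      rw [smul_mulVec, Pi.smul_apply, smul_eq_mul, mul_comm]
      congr 1
      have h3 := map_mulVec_one (A ^ (k : ℕ)) i
      have h4 : (A ^ (k : ℕ)).map (algebraMap ℤ ℂ) = A.map (algebraMap ℤ ℂ) ^ (k : ℕ) :=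
        map_pow (RingHom.mapMatrix (algebraMap ℤ ℂ)) A k
      rw [h4] at h3
      exact h3.symm
    have h2 := exists_mulVec_eq_zero_iff.1 ⟨_, hne, h1⟩
    have h3 : (K.map (algebraMap ℤ ℂ)).det = algebraMap ℤ ℂ K.det :=
      (RingHom.map_det (algebraMap ℤ ℂ) K).symm
    rw [h3] at h2
    exact hK ((map_eq_zero_iff _ (algebraMap ℤ ℂ).injective_int).1 h2)
  have hQz : Q = 0 := by
    ext k
    rcases lt_or_ge k d with hk | hk
    · exact congrFun hQ0 ⟨k, hk⟩
    · rw [Polynomial.coeff_eq_zero_of_natDegree_lt (hQdeg.trans_le hk), Polynomial.coeff_zero]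
  have h1 := eval_basis b b hb hb
  rw [← hQ, hQz, if_pos rfl, Polynomial.eval_zero] at h1
  exact zero_ne_one h1

theorem sum_conjugates (h : IsSalemNumber α) (f : ℂ → ℂ) :
    ∑ b ∈ conjugates α, f b =
      f α + f (α : ℂ)⁻¹ + ∑ z : upperConjugates α, (f z + f ((starRingEnd ℂ) (z : ℂ))) := by
  classical
  have hα := h.one_lt
  have hsplit : conjugates α = {(α : ℂ), (α : ℂ)⁻¹} ∪ (upperConjugates α ∪
      (upperConjugates α).image (starRingEnd ℂ)) := by
    ext z
    simp only [Finset.mem_union, Finset.mem_insert, Finset.mem_singleton, Finset.mem_image]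
    constructor
    · intro hz
      by_cases h1 : z = α
      · exact Or.inl (Or.inl h1)
      by_cases h2 : z = (α : ℂ)⁻¹
      · exact Or.inl (Or.inr h2)
      rcases h.upper_or_conj_upper hz (h.norm_eq_one hz h1 h2) with hu | hu
      · exact Or.inr (Or.inl hu)
      · exact Or.inr (Or.inr ⟨_, hu, Complex.conj_conj z⟩)
    · rintro ((rfl | rfl) | hu | ⟨w, hw, rfl⟩)
      · exact h.self_mem_conjugates
      · exact h.inv_self_mem_conjugates
      · exact (mem_upperConjugates.1 hu).1
      · exact h.conj_mem_conjugates (mem_upperConjugates.1 hw).1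
  have hne : (α : ℂ) ≠ (α : ℂ)⁻¹ := by
    rw [← Complex.ofReal_inv]
    intro h0
    have h1 : α = α⁻¹ := by exact_mod_cast h0
    have h2 := inv_lt_one_of_one_lt₀ hα
    linarith
  rw [hsplit, Finset.sum_union, Finset.sum_pair hne, Finset.sum_union, Finset.sum_image,
    ← Finset.sum_add_distrib, Finset.sum_coe_sort (upperConjugates α)
      (fun z => f z + f ((starRingEnd ℂ) z))]
  · exact fun x _ y _ hxy => (starRingEnd ℂ).injective hxy
  · rw [Finset.disjoint_left]
    intro z hz hz'
    obtain ⟨w, hw, rfl⟩ := Finset.mem_image.1 hz'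
    have h1 := (mem_upperConjugates.1 hz).2.2
    have h2 := (mem_upperConjugates.1 hw).2.2
    rw [Complex.conj_im] at h1
    linarith
  · rw [Finset.disjoint_left]
    intro z hz hz'
    have him : z.im = 0 := by
      rcases Finset.mem_insert.1 hz with rfl | hz
      · exact Complex.ofReal_im _
      · rw [Finset.mem_singleton.1 hz, ← Complex.ofReal_inv]; exact Complex.ofReal_im _
    rcases Finset.mem_union.1 hz' with hu | hu
    · exact (mem_upperConjugates.1 hu).2.2.ne' him
    · obtain ⟨w, hw, rfl⟩ := Finset.mem_image.1 hu
      have := (mem_upperConjugates.1 hw).2.2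
      rw [Complex.conj_im] at him
      linarith

end IsSalemNumber

end Eigen

/-! ### The distance from the dual lattice and the orbit -/

section Dual

variable {d : ℕ} (Γ : Submodule ℤ (Fin d → ℤ))

theorem dualLattice_nonempty : (dualLattice Γ).Nonempty :=
  ⟨0, fun z _ => ⟨0, by simp⟩⟩

variable {Γ}

theorem add_intCast_mem_dualLattice {u : Fin d → ℝ} (hu : u ∈ dualLattice Γ) (k : Fin d → ℤ) :
    (fun i => u i + (k i : ℝ)) ∈ dualLattice Γ := by
  intro z hz
  obtain ⟨a, ha⟩ := hu z hz
  refine ⟨a + ∑ i, k i * z i, ?_⟩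
  push_cast
  rw [← ha, ← Finset.sum_add_distrib]
  exact Finset.sum_congr rfl fun i _ => by ring

theorem torusNorm_add_intCast_le (u : Fin d → ℝ) (k : Fin d → ℤ) :
    torusNorm Γ (fun i => u i + (k i : ℝ)) ≤ torusNorm Γ u := by
  refine (Metric.le_infDist (dualLattice_nonempty Γ)).2 fun v hv => ?_
  refine (Metric.infDist_le_dist_of_mem (add_intCast_mem_dualLattice hv k)).trans ?_
  rw [dist_eq_norm, dist_eq_norm]
  refine le_of_eq (congrArg _ ?_)
  funext i
  simp

theorem torusNorm_add_intCast (u : Fin d → ℝ) (k : Fin d → ℤ) :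
    torusNorm Γ (fun i => u i + (k i : ℝ)) = torusNorm Γ u := by
  refine le_antisymm (torusNorm_add_intCast_le u k) ?_
  have := torusNorm_add_intCast_le (Γ := Γ) (fun i => u i + (k i : ℝ)) (fun i => -k i)
  simpa using this

theorem continuous_torusNorm : Continuous (torusNorm Γ) :=
  Metric.continuous_infDist_pt _

theorem abs_torusNorm_sub_le (u v : Fin d → ℝ) : |torusNorm Γ u - torusNorm Γ v| ≤ ‖u - v‖ := by
  have := (Metric.lipschitz_infDist_pt (dualLattice Γ)).dist_le_mul u v
  rw [← dist_eq_norm]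
  simpa [Real.dist_eq, torusNorm] using this

/-- A lattice of full rank contains `m ℤᵈ` for some `m ≥ 1`. -/
theorem exists_pos_smul_mem (hrank : Module.finrank ℤ Γ = d) :
    ∃ m : ℕ, 0 < m ∧ ∀ x : Fin d → ℤ, m • x ∈ Γ := by
  have hfin : Finite ((Fin d → ℤ) ⧸ Γ) := by
    rw [Submodule.finiteQuotient_iff, hrank, Module.finrank_fin_fun]
  refine ⟨Nat.card ((Fin d → ℤ) ⧸ Γ), Nat.card_pos, fun x => ?_⟩
  rw [← Submodule.Quotient.mk_eq_zero, Submodule.Quotient.mk_smul]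
  exact card_nsmul_eq_zero'

theorem exists_int_mul_eq_of_mem_dualLattice {m : ℕ} (hm : ∀ x : Fin d → ℤ, m • x ∈ Γ)
    {v : Fin d → ℝ} (hv : v ∈ dualLattice Γ) (i : Fin d) : ∃ k : ℤ, m * v i = k := by
  obtain ⟨k, hk⟩ := hv _ (hm (Pi.single i 1))
  refine ⟨k, ?_⟩
  rw [← hk, Finset.sum_eq_single i]
  · simp [mul_comm]
  · intro j _ hj
    simp [Pi.single_eq_of_ne hj]
  · simp

theorem exists_mem_dualLattice_of_torusNorm_lt {u : Fin d → ℝ} {ε : ℝ} (h : torusNorm Γ u < ε) :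
    ∃ v ∈ dualLattice Γ, ∀ i, |u i - v i| < ε := by
  obtain ⟨v, hv, huv⟩ := (Metric.infDist_lt_iff (dualLattice_nonempty Γ)).1 h
  refine ⟨v, hv, fun i => ?_⟩
  rw [← Real.dist_eq]
  exact (dist_le_pi_dist u v i).trans_lt huv

theorem near_int_of_torusNorm_lt {m : ℕ} (hm0 : 0 < m) (hm : ∀ x : Fin d → ℤ, m • x ∈ Γ)
    {u : Fin d → ℝ} {ε : ℝ} (h : torusNorm Γ u < ε) (i : Fin d) :
    ∃ k : ℤ, |m * u i - k| < m * ε := by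
  obtain ⟨v, hv, huv⟩ := exists_mem_dualLattice_of_torusNorm_lt h
  obtain ⟨k, hk⟩ := exists_int_mul_eq_of_mem_dualLattice hm hv i
  refine ⟨k, ?_⟩
  have hm' : (0 : ℝ) < m := by exact_mod_cast hm0
  rw [← hk, ← mul_sub, abs_mul, abs_of_pos hm']
  exact mul_lt_mul_of_pos_left (huv i) hm'

end Dual

section Orbit

open Matrix

variable {d : ℕ} {A : Matrix (Fin d) (Fin d) ℤ} {α : ℝ}

namespace IsSalemNumber

/-- The difference of the vectors `ω Aⁿ 𝟏` and `L⁻¹ P(A) Aⁿ 𝟏`, where `ω = P(α) / L`, has no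
component in the expanding direction of `A`: it is the sum of a contracted and of a rotating part.
-/
theorem orbit_eq (h : IsSalemNumber α)
    (hA : A.charpoly.map (Int.castRingHom ℚ) = minpoly ℚ α) {ω : ℝ} {P : Polynomial ℤ} {L : ℝ}
    (hω : ω = Polynomial.aeval α P / L) (n : ℕ) (i : Fin d) :
    ω * (((A ^ n *ᵥ 1) i : ℤ) : ℝ) =
      ((((Polynomial.aeval A P * A ^ n) *ᵥ 1) i : ℤ) : ℝ) / L +
      ((ω - Polynomial.aeval (α : ℂ)⁻¹ P / L) * eigenComponent A α (α : ℂ)⁻¹ i *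
        (α : ℂ)⁻¹ ^ n).re +
      ∑ z : upperConjugates α, (2 * (ω - Polynomial.aeval (z : ℂ) P / L) *
        eigenComponent A α z i * (z : ℂ) ^ n).re := by
  set f : ℂ → ℂ := fun b => (ω - Polynomial.aeval b P / L) * eigenComponent A α b i * b ^ n with hf
  have hint : ∀ Q : Polynomial ℤ, ((((Polynomial.aeval A Q) *ᵥ 1) i : ℤ) : ℂ) =
      ∑ b ∈ conjugates α, Polynomial.aeval b Q * eigenComponent A α b i := by
    intro Q
    have h1 := congrFun (h.aeval_mulVec_one hA (Q.map (algebraMap ℤ ℂ))) i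
    rw [aeval_int_matrix, map_mulVec_one, Finset.sum_apply] at h1
    rw [h1]
    exact Finset.sum_congr rfl fun b _ => by
      rw [Pi.smul_apply, smul_eq_mul, Polynomial.eval_map_algebraMap]
  have h1 := hint (Polynomial.X ^ n)
  have h2 := hint (P * Polynomial.X ^ n)
  simp only [map_pow, map_mul, Polynomial.aeval_X] at h1 h2
  have hsum : (ω : ℂ) * (((A ^ n *ᵥ 1) i : ℤ) : ℂ) -
      ((((Polynomial.aeval A P * A ^ n) *ᵥ 1) i : ℤ) : ℂ) / L = ∑ b ∈ conjugates α, f b := by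
    rw [h1, h2, Finset.mul_sum, Finset.sum_div, ← Finset.sum_sub_distrib]
    exact Finset.sum_congr rfl fun b _ => by simp only [hf]; ring
  have hfα : f α = 0 := by
    simp only [hf]
    rw [aeval_ofReal, hω]; push_cast; ring
  have hfconj : ∀ z : upperConjugates α, f ((starRingEnd ℂ) (z : ℂ)) = (starRingEnd ℂ) (f z) := by
    intro z
    simp only [hf, map_mul, map_sub, map_div₀, map_pow, Complex.conj_ofReal, conj_aeval]
    rw [h.eigenComponent_conj hA (mem_upperConjugates.1 z.2).1]
  rw [h.sum_conjugates, hfα, zero_add] at hsum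
  have hre := congrArg Complex.re hsum
  have hl : ((ω : ℂ) * (((A ^ n *ᵥ 1) i : ℤ) : ℂ) -
      ((((Polynomial.aeval A P * A ^ n) *ᵥ 1) i : ℤ) : ℂ) / L).re =
      ω * (((A ^ n *ᵥ 1) i : ℤ) : ℝ) - ((((Polynomial.aeval A P * A ^ n) *ᵥ 1) i : ℤ) : ℝ) / L := by
    rw [← Complex.ofReal_re (ω * (((A ^ n *ᵥ 1) i : ℤ) : ℝ) -
      ((((Polynomial.aeval A P * A ^ n) *ᵥ 1) i : ℤ) : ℝ) / L)]
    push_cast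
    rfl
  rw [hl, Complex.add_re, Complex.re_sum] at hre
  have hz : ∀ z : upperConjugates α, (f z + f ((starRingEnd ℂ) (z : ℂ))).re =
      (2 * (ω - Polynomial.aeval (z : ℂ) P / L) * eigenComponent A α z i * (z : ℂ) ^ n).re := by
    intro z
    rw [hfconj, Complex.add_conj, Complex.ofReal_re, ← Complex.re_ofReal_mul]
    congr 1
    simp only [hf]
    push_cast
    ring
  simp only [hz] at hre
  linarith

end IsSalemNumber

theorem orbitVec_apply (A : GL (Fin d) ℤ) (ω : ℝ) (n : ℕ) (i : Fin d) :
    orbitVec A ω n i = ω * ((((A : Matrix (Fin d) (Fin d) ℤ) ^ n *ᵥ 1) i : ℤ) : ℝ) := by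
  simp [orbitVec, mulVec, dotProduct]

end Orbit

section Frequencies

/-- The point of the torus whose coordinates are the normalized arguments of the conjugates on the
upper half of the unit circle. -/
noncomputable def angles (α : ℝ) : UnitAddTorus (upperConjugates α) :=
  fun z => (((z : ℂ).arg / (2 * Real.pi) : ℝ) : UnitAddCircle)

theorem toCircle_angles {α : ℝ} (z : upperConjugates α) :
    (AddCircle.toCircle (angles α z) : ℂ) = z := by
  have h1 := Complex.norm_mul_exp_arg_mul_I (z : ℂ)
  rw [(IsSalemNumber.mem_upperConjugates.1 z.2).2.1, Complex.ofReal_one, one_mul] at h1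
  rw [angles, AddCircle.toCircle_apply_mk, Circle.coe_exp]
  conv_rhs => rw [← h1]
  congr 2
  have := Real.pi_ne_zero
  push_cast
  field_simp

theorem IsSalemNumber.mFourier_angles_ne_one {α : ℝ} (h : IsSalemNumber α) {q : ℕ} (hq : 0 < q)
    (n : upperConjugates α → ℤ) (hn : n ≠ 0) : UnitAddTorus.mFourier n (q • angles α) ≠ 1 := by
  intro h1
  apply hn
  have h2 : UnitAddTorus.mFourier n (q • angles α) =
      ∏ z : upperConjugates α, (z : ℂ) ^ ((q : ℤ) * n z) := by
    rw [mFourier_nsmul_apply]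
    simp only [UnitAddTorus.mFourier, ContinuousMap.coe_mk, fourier_apply]
    rw [← Finset.prod_pow]
    refine Finset.prod_congr rfl fun z _ => ?_
    rw [AddCircle.toCircle_zsmul, Circle.coe_zpow, toCircle_angles, mul_comm, zpow_mul,
      zpow_natCast]
  rw [h2] at h1
  have h3 := h.eq_zero_of_prod_zpow_eq_one (fun z => (q : ℤ) * n z) h1
  funext z
  have h4 := congrFun h3 z
  simp only [Pi.zero_apply, mul_eq_zero] at h4
  exact h4.resolve_left (by exact_mod_cast hq.ne')

end Frequencies

/-! ### Existence and size of the density -/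

section Density

open Classical in
theorem tendsto_ncard_div {F : ℕ → ℝ} {δ f : ℝ}
    (hf : Tendsto (fun N : ℕ => (N : ℝ)⁻¹ * ∑ k ∈ Finset.range N, if δ ≤ F k then (1 : ℝ) else 0)
      atTop (𝓝 f)) :
    Tendsto (fun N : ℕ => (Set.ncard {n : ℕ | n ≤ N ∧ δ ≤ F n} : ℝ) / (N : ℝ)) atTop (𝓝 f) := by
  have hcard : ∀ N : ℕ, (Set.ncard {n : ℕ | n ≤ N ∧ δ ≤ F n} : ℝ) =
      ∑ k ∈ Finset.range (N + 1), if δ ≤ F k then (1 : ℝ) else 0 := by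
    intro N
    have h1 : {n : ℕ | n ≤ N ∧ δ ≤ F n} =
        (((Finset.range (N + 1)).filter fun n => δ ≤ F n : Finset ℕ) : Set ℕ) := by
      ext n; simp
    rw [h1, Set.ncard_coe_finset, ← Finset.sum_filter, Finset.sum_const, nsmul_one]
  have h1 := hf.comp (tendsto_add_atTop_nat 1)
  have h2 : Tendsto (fun N : ℕ => 1 + (N : ℝ)⁻¹) atTop (𝓝 (1 + 0)) :=
    (tendsto_inv_atTop_nhds_zero_nat (𝕜 := ℝ)).const_add 1
  have h3 := h2.mul h1
  rw [add_zero, one_mul] at h3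
  refine h3.congr' ?_
  filter_upwards [eventually_gt_atTop 0] with N hN
  have hN' : (N : ℝ) ≠ 0 := by exact_mod_cast hN.ne'
  have hN1 : (N : ℝ) + 1 ≠ 0 := by positivity
  rw [hcard]
  simp only [Function.comp_apply]
  push_cast
  field_simp

end Density

section Periodic

open Matrix

variable {d : ℕ}

/-- The powers of an invertible integer matrix are periodic modulo `L`. -/
theorem exists_period (A : GL (Fin d) ℤ) {L : ℕ} (hL : 0 < L) :
    ∃ q : ℕ, 0 < q ∧ ∀ k : ℕ, ∃ B : Matrix (Fin d) (Fin d) ℤ,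
      (A : Matrix (Fin d) (Fin d) ℤ) ^ (q * k) = 1 + (L : ℤ) • B := by
  have : NeZero L := ⟨hL.ne'⟩
  let φ : Matrix (Fin d) (Fin d) ℤ →+* Matrix (Fin d) (Fin d) (ZMod L) :=
    RingHom.mapMatrix (Int.castRingHom (ZMod L))
  have hfin : Finite (Matrix (Fin d) (Fin d) (ZMod L))ˣ :=
    Finite.of_injective _ Units.val_injective
  let u := Units.map (φ : Matrix (Fin d) (Fin d) ℤ →* Matrix (Fin d) (Fin d) (ZMod L)) A
  refine ⟨orderOf u, (isOfFinOrder_of_finite u).orderOf_pos, fun k => ?_⟩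
  have h1 : u ^ (orderOf u * k) = 1 := by rw [pow_mul, pow_orderOf_eq_one, one_pow]
  have h2 : φ ((A : Matrix (Fin d) (Fin d) ℤ) ^ (orderOf u * k) - 1) = 0 := by
    rw [map_sub, map_pow, map_one, sub_eq_zero]
    exact congrArg Units.val h1
  have h3 : ∀ i j, ∃ c : ℤ, ((A : Matrix (Fin d) (Fin d) ℤ) ^ (orderOf u * k) - 1) i j = L * c := by
    intro i j
    have h4 := congrFun (congrFun h2 i) j
    exact (ZMod.intCast_zmod_eq_zero_iff_dvd _ L).1 h4
  choose B hB using h3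
  refine ⟨Matrix.of B, ?_⟩
  rw [← sub_eq_iff_eq_add']
  ext i j
  rw [hB]; simp

/-- The orbit of a vector under an invertible integer matrix, taken modulo `L`, has a period of at
most `Lᵈ`. -/
theorem exists_orbit_period_le (A : GL (Fin d) ℤ) {L : ℕ} (hL : 0 < L) (x : Fin d → ℤ) :
    ∃ q : ℕ, 0 < q ∧ q ≤ L ^ d ∧ ∀ n : ℕ, ∃ y : Fin d → ℤ,
      (A : Matrix (Fin d) (Fin d) ℤ) ^ (n + q) *ᵥ x =
        (A : Matrix (Fin d) (Fin d) ℤ) ^ n *ᵥ x + (L : ℤ) • y := by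
  have : NeZero L := ⟨hL.ne'⟩
  let red : (Fin d → ℤ) → (Fin d → ZMod L) := fun v i => (v i : ZMod L)
  have hred : ∀ v w : Fin d → ℤ, red v = red w → ∃ y : Fin d → ℤ, v = w + (L : ℤ) • y := by
    intro v w hvw
    have h1 : ∀ i, ∃ c : ℤ, v i - w i = L * c := fun i => by
      have h2 : ((v i - w i : ℤ) : ZMod L) = 0 := by
        rw [Int.cast_sub, sub_eq_zero]; exact congrFun hvw i
      exact (ZMod.intCast_zmod_eq_zero_iff_dvd _ L).1 h2
    choose y hy using h1
    refine ⟨y, ?_⟩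
    funext i
    have := hy i
    simp only [Pi.add_apply, Pi.smul_apply, smul_eq_mul]
    linarith
  have hcard : Fintype.card (Fin d → ZMod L) < Fintype.card (Fin (L ^ d + 1)) := by
    simp [ZMod.card]
  obtain ⟨i, j, hij, heq⟩ := Fintype.exists_ne_map_eq_of_card_lt
    (fun n : Fin (L ^ d + 1) => red ((A : Matrix (Fin d) (Fin d) ℤ) ^ (n : ℕ) *ᵥ x)) hcard
  -- two of the first `Lᵈ + 1` points agree modulo `L`; cancel the power of `A` of the first one
  wlog hlt : i < j generalizing i j
  · exact this j i hij.symm heq.symm (lt_of_le_of_ne (not_lt.1 hlt) hij.symm)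
  have hlt' : (i : ℕ) < j := hlt
  have hj : (j : ℕ) < L ^ d + 1 := j.2
  refine ⟨j - i, by omega, by omega, fun n => ?_⟩
  obtain ⟨y, hy⟩ := hred _ _ heq.symm
  have hsplit : (A : Matrix (Fin d) (Fin d) ℤ) ^ (j : ℕ) =
      (A : Matrix (Fin d) (Fin d) ℤ) ^ (i : ℕ) * (A : Matrix (Fin d) (Fin d) ℤ) ^ ((j : ℕ) - i) := by
    rw [← pow_add]; congr 1; omega
  let C : Matrix (Fin d) (Fin d) ℤ := ((A⁻¹ ^ (i : ℕ) : GL (Fin d) ℤ) : Matrix (Fin d) (Fin d) ℤ)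
  have hC : C * (A : Matrix (Fin d) (Fin d) ℤ) ^ (i : ℕ) = 1 := by
    have h1 : (A⁻¹ ^ (i : ℕ) * A ^ (i : ℕ) : GL (Fin d) ℤ) = 1 := by
      rw [inv_pow, inv_mul_cancel]
    exact congrArg Units.val h1
  have h2 : (A : Matrix (Fin d) (Fin d) ℤ) ^ ((j : ℕ) - i) *ᵥ x = x + (L : ℤ) • C *ᵥ y := by
    have h3 := congrArg (C *ᵥ ·) hy
    simp only [mulVec_add, mulVec_smul, mulVec_mulVec] at h3
    rw [hsplit, ← mul_assoc, hC, one_mul, one_mulVec] at h3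
    exact h3
  refine ⟨(A : Matrix (Fin d) (Fin d) ℤ) ^ n *ᵥ (C *ᵥ y), ?_⟩
  rw [pow_add, ← mulVec_mulVec, h2, mulVec_add, mulVec_smul]

end Periodic

section Rotation

/-- The trigonometric polynomial on the torus through which the rotating part of the orbit
factors. -/
noncomputable def rotatingPart {d : ℕ} {J : Type*} [Fintype J] (u : J → Fin d → ℂ)
    (θ : UnitAddTorus J) (i : Fin d) : ℝ :=
  ∑ z, (u z i * (AddCircle.toCircle (θ z) : ℂ)).re

variable {d : ℕ} {J : Type*} [Fintype J]

theorem continuous_rotatingPart (u : J → Fin d → ℂ) : Continuous (rotatingPart u) := by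
  refine continuous_pi fun i => continuous_finsetSum _ fun z _ => ?_
  have := (AddCircle.continuous_toCircle (T := 1)).comp (continuous_apply z :
      Continuous fun θ : UnitAddTorus J => θ z)
  fun_prop

/-- The vector `r + rotatingPart u θ` is near the dual lattice with probability at most `1 / 2`: its
`i`-th coordinate, multiplied by `m`, would be near an integer. -/
theorem measureReal_torusNorm_lt_le_half [DecidableEq J] {Γ : Submodule ℤ (Fin d → ℤ)} {m : ℕ}
    (hm0 : 0 < m) (hm : ∀ x : Fin d → ℤ, m • x ∈ Γ)
    (μ : Measure (UnitAddTorus J)) [IsProbabilityMeasure μ] [μ.IsAddLeftInvariant]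
    (u : J → Fin d → ℂ) (r : Fin d → ℝ) {j : J} {i : Fin d} (hu : u j i ≠ 0) {δ : ℝ}
    (hδ : m * δ ≤ min 1 (m * ‖u j i‖) / 64) :
    μ.real {θ | torusNorm Γ (fun i => r i + rotatingPart u θ i) < δ} ≤ 1 / 2 := by
  have hm' : (m : ℂ) ≠ 0 := by exact_mod_cast hm0.ne'
  set c : UnitAddTorus J → ℝ := fun θ =>
    m * (r i + ∑ z ∈ Finset.univ.erase j, (u z i * (AddCircle.toCircle (θ z) : ℂ)).re) with hc
  have hcont : Continuous c := by
    refine continuous_const.mul (continuous_const.add (continuous_finsetSum _ fun z _ => ?_))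
    have := (AddCircle.continuous_toCircle (T := 1)).comp (continuous_apply z :
      Continuous fun θ : UnitAddTorus J => θ z)
    fun_prop
  have hnorm : ‖(m : ℂ) * u j i‖ = m * ‖u j i‖ := by rw [norm_mul, Complex.norm_natCast]
  refine le_trans (measureReal_mono ?_ (measure_ne_top _ _))
    (measureReal_near_int_le_half μ j hcont ?_ (mul_ne_zero hm' hu) (hnorm ▸ hδ))
  · intro θ hθ
    obtain ⟨k, hk⟩ := near_int_of_torusNorm_lt hm0 hm hθ i
    refine ⟨k, ?_⟩
    have h1 : c θ + ((m : ℂ) * u j i * (AddCircle.toCircle (θ j) : ℂ)).re =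
        m * (r i + rotatingPart u θ i) := by
      rw [rotatingPart, ← Finset.add_sum_erase _ _ (Finset.mem_univ j), hc, mul_assoc,
        ← Complex.ofReal_natCast, Complex.re_ofReal_mul]
      ring
    rw [h1]
    exact hk
  · intro t θ
    simp only [hc]
    congr 2
    refine Finset.sum_congr rfl fun z hz => ?_
    rw [Pi.add_apply, Pi.single_eq_of_ne (Finset.ne_of_mem_erase hz), zero_add]

end Rotation

section Irrational

open Matrix

variable {d : ℕ} {α : ℝ}

/-- If the rotating part of the orbit has an amplitude of at least `ρ`, then for some `δ` between
`a` and `2a` the density of `{n | δ ≤ ‖ω Aⁿ 𝟏‖}` exists and is at least `1 / 2`. -/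
theorem IsSalemNumber.exists_density_of_rotation (h : IsSalemNumber α) (A : GL (Fin d) ℤ)
    (hA : (A : Matrix (Fin d) (Fin d) ℤ).charpoly.map (Int.castRingHom ℚ) = minpoly ℚ α)
    {Γ : Submodule ℤ (Fin d → ℤ)} {m : ℕ} (hm0 : 0 < m) (hm : ∀ x : Fin d → ℤ, m • x ∈ Γ)
    {ω : ℝ} {P : Polynomial ℤ} {L : ℕ} (hL : 0 < L) (hω : ω = Polynomial.aeval α P / L)
    (z : upperConjugates α) (i : Fin d) {ρ : ℝ} (hρ : 0 < ρ)
    (hρz : ρ ≤ ‖(ω - Polynomial.aeval (z : ℂ) P / L) *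
      eigenComponent (A : Matrix (Fin d) (Fin d) ℤ) α z i‖)
    {a : ℝ} (ha : 0 < a) (ham : m * (2 * a) ≤ min 1 (m * (2 * ρ)) / 64) :
    ∃ δ : ℝ, a ≤ δ ∧ ∃ f : ℝ, Tendsto (fun N : ℕ =>
      (Set.ncard {n : ℕ | n ≤ N ∧ δ ≤ torusNorm Γ (orbitVec A ω n)} : ℝ) / (N : ℝ)) atTop (𝓝 f) ∧
      1 / 2 ≤ f := by
  classical
  let μ : Measure (UnitAddTorus (upperConjugates α)) :=
    Measure.pi fun _ => AddCircle.haarAddCircle (T := 1)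
  obtain ⟨q, hq, hper⟩ := exists_period A hL
  have hL' : (L : ℝ) ≠ 0 := by exact_mod_cast hL.ne'
  set V := eigenComponent (A : Matrix (Fin d) (Fin d) ℤ) α with hV
  set x := angles α with hx
  let u : upperConjugates α → Fin d → ℂ := fun z i =>
    2 * (ω - Polynomial.aeval (z : ℂ) P / L) * V z i
  let r : ℕ → Fin d → ℤ := fun n =>
    (Polynomial.aeval (A : Matrix (Fin d) (Fin d) ℤ) P * (A : Matrix (Fin d) (Fin d) ℤ) ^ n) *ᵥ 1
  let G : ℕ → UnitAddTorus (upperConjugates α) → ℝ := fun s θ =>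
    torusNorm Γ (fun i => (r s i : ℝ) / L + rotatingPart u θ i)
  let e : ℕ → Fin d → ℝ := fun n i =>
    ((ω - Polynomial.aeval (α : ℂ)⁻¹ P / L) * V (α : ℂ)⁻¹ i * (α : ℂ)⁻¹ ^ n).re
  have hG : ∀ s, Continuous (G s) := fun s => by
    refine continuous_torusNorm.comp (continuous_pi fun i => continuous_const.add ?_)
    exact (continuous_apply i).comp (continuous_rotatingPart u)
  have he : Tendsto e atTop (𝓝 0) := by
    refine tendsto_pi_nhds.2 fun i => ?_
    have h1 : ‖(α : ℂ)⁻¹‖ < 1 := by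
      rw [norm_inv, Complex.norm_real, Real.norm_of_nonneg (zero_lt_one.trans h.one_lt).le]
      exact inv_lt_one_of_one_lt₀ h.one_lt
    have h2 := (tendsto_pow_atTop_nhds_zero_of_norm_lt_one h1).const_mul
      ((ω - Polynomial.aeval (α : ℂ)⁻¹ P / L) * V (α : ℂ)⁻¹ i)
    rw [mul_zero] at h2
    exact (Complex.continuous_re.tendsto _).comp h2
  have horb : ∀ n i, orbitVec A ω n i = (r n i : ℝ) / L + e n i + rotatingPart u (n • x) i := by
    intro n i
    have hrot : rotatingPart u (n • x) i = ∑ z : upperConjugates α,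
        (2 * (ω - Polynomial.aeval (z : ℂ) P / (L : ℝ)) * V z i * (z : ℂ) ^ n).re := by
      refine Finset.sum_congr rfl fun z _ => ?_
      rw [Pi.smul_apply, AddCircle.toCircle_nsmul, Circle.coe_pow, hx, toCircle_angles]
      simp [u]
    rw [orbitVec_apply, h.orbit_eq hA hω n i, hrot]
    simp [r, e, hV]
  have hrper : ∀ s k, ∃ y : Fin d → ℤ, r (s + q * k) = r s + (L : ℤ) • y := by
    intro s k
    obtain ⟨B, hB⟩ := hper k
    refine ⟨(Polynomial.aeval (A : Matrix (Fin d) (Fin d) ℤ) P *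
      (A : Matrix (Fin d) (Fin d) ℤ) ^ s * B) *ᵥ 1, ?_⟩
    simp only [r]
    rw [pow_add, hB, ← mul_assoc, mul_add, mul_one, add_mulVec, mul_smul_comm, smul_mulVec]
  have hFG : ∀ s, Tendsto (fun k => torusNorm Γ (orbitVec A ω (s + q * k)) -
      G s (s • x + k • (q • x))) atTop (𝓝 0) := by
    intro s
    have htend : Tendsto (fun k : ℕ => s + q * k) atTop atTop :=
      tendsto_atTop_mono
        (fun k => (Nat.le_mul_of_pos_left k hq).trans (Nat.le_add_left _ _)) tendsto_id
    refine squeeze_zero_norm (a := fun k : ℕ => ‖e (s + q * k)‖) (fun k => ?_) ?_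
    · obtain ⟨y, hy⟩ := hrper s k
      have hxx : s • x + k • (q • x) = (s + q * k) • x := by
        rw [add_nsmul, mul_nsmul]
      have h1 : orbitVec A ω (s + q * k) = fun i => ((r s i : ℝ) / L + e (s + q * k) i +
          rotatingPart u ((s + q * k) • x) i) + (y i : ℝ) := by
        funext i
        rw [horb, hy]
        simp only [Pi.add_apply, Pi.smul_apply, smul_eq_mul]
        push_cast
        field_simp
        ring
      rw [h1, torusNorm_add_intCast, hxx, Real.norm_eq_abs]
      refine (abs_torusNorm_sub_le _ _).trans (le_of_eq (congrArg _ ?_))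
      funext i
      simp only [Pi.sub_apply]
      ring
    · simpa using (he.comp htend).norm
  -- a level `δ` without mass in the limit distributions
  have hbad : (⋃ s, {t | 0 < μ {θ | G s θ = t}}).Countable :=
    Set.countable_iUnion fun s => Measure.countable_meas_level_set_pos (hG s).measurable
  obtain ⟨δ, hδbad, haδ, hδa⟩ := (hbad.dense_compl ℝ).exists_between (by linarith : a < 2 * a)
  have hnull : ∀ s, μ {θ | G s θ = δ} = 0 := fun s => by
    by_contra hne
    exact hδbad (Set.mem_iUnion.2 ⟨s, pos_iff_ne_zero.2 hne⟩)
  have hlim : ∀ s < q, Tendsto (fun K : ℕ => (K : ℝ)⁻¹ * ∑ k ∈ Finset.range K,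
      if δ ≤ torusNorm Γ (orbitVec A ω (s + q * k)) then (1 : ℝ) else 0) atTop
      (𝓝 (μ.real {θ | δ ≤ G s θ})) := fun s _ => by
    convert density_superlevel_tendsto μ (q • x) (h.mFourier_angles_ne_one hq) (hG s) (s • x)
      (hFG s) (hnull s)
  have htot := average_tendsto_of_residues hq
    (b := fun n => if δ ≤ torusNorm Γ (orbitVec A ω n) then (1 : ℝ) else 0)
    (fun n => by split_ifs <;> simp) hlim
  refine ⟨δ, haδ.le, (q : ℝ)⁻¹ * ∑ s ∈ Finset.range q, μ.real {θ | δ ≤ G s θ},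
    tendsto_ncard_div ?_, ?_⟩
  · convert htot
  · have hq' : (0 : ℝ) < q := by exact_mod_cast hq
    rw [le_inv_mul_iff₀ hq']
    have hunorm : 2 * ρ ≤ ‖u z i‖ := by
      simp only [u]
      rw [mul_assoc, norm_mul, Complex.norm_two]
      exact mul_le_mul_of_nonneg_left hρz zero_le_two
    have hm' : (0 : ℝ) < m := by exact_mod_cast hm0
    have hhalf : ∀ s, 1 / 2 ≤ μ.real {θ | δ ≤ G s θ} := fun s => by
      have h1 : μ.real {θ | G s θ < δ} ≤ 1 / 2 := by
        refine measureReal_torusNorm_lt_le_half hm0 hm μ u (fun i => (r s i : ℝ) / L) (j := z)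
          (i := i) (norm_pos_iff.1 (lt_of_lt_of_le (by positivity) hunorm)) ?_
        calc m * δ ≤ m * (2 * a) := by gcongr
          _ ≤ _ := ham
          _ ≤ _ := by gcongr
      have h2 : {θ | δ ≤ G s θ} = {θ | G s θ < δ}ᶜ := by ext; simp
      rw [h2, probReal_compl_eq_one_sub (measurableSet_lt (hG s).measurable measurable_const)]
      linarith
    calc (q : ℝ) * (1 / 2) = ∑ _s ∈ Finset.range q, (1 / 2 : ℝ) := by simp
      _ ≤ _ := Finset.sum_le_sum fun s _ => hhalf s

end Irrational

/-! ### Rational multiples, effective bounds and the conclusion -/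

section Rational

open Matrix

variable {d : ℕ}

open Classical in
/-- For `ω ∈ L⁻¹ ℤ` the orbit is periodic modulo `ℤᵈ` with a period of at most `Lᵈ`. Its initial
point has distance at least `1 / (L m)` from `Γ*`, since both lie in `(L m)⁻¹ ℤᵈ`. -/
theorem exists_density_of_rational (A : GL (Fin d) ℤ) {Γ : Submodule ℤ (Fin d → ℤ)} {m : ℕ}
    (hm0 : 0 < m) (hm : ∀ x : Fin d → ℤ, m • x ∈ Γ) {ω : ℝ} {t : ℤ} {L : ℕ} (hL : 0 < L)
    (hω : ω = t / L) (hdual : (fun _ : Fin d => ω) ∉ dualLattice Γ) {a : ℝ}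
    (ha : a ≤ 1 / (L * m)) :
    ∃ f : ℝ, Tendsto (fun N : ℕ =>
      (Set.ncard {n : ℕ | n ≤ N ∧ a ≤ torusNorm Γ (orbitVec A ω n)} : ℝ) / (N : ℝ)) atTop (𝓝 f) ∧
      1 / (L : ℝ) ^ d ≤ f := by
  have hL' : (0 : ℝ) < L := by exact_mod_cast hL
  have hm' : (0 : ℝ) < m := by exact_mod_cast hm0
  obtain ⟨q, hq, hqL, hper⟩ := exists_orbit_period_le A hL 1
  have hq' : (0 : ℝ) < q := by exact_mod_cast hq
  have hFq : ∀ n, torusNorm Γ (orbitVec A ω (n + q)) = torusNorm Γ (orbitVec A ω n) := by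
    intro n
    obtain ⟨y, hy⟩ := hper n
    rw [← torusNorm_add_intCast (orbitVec A ω n) (fun i => t * y i)]
    congr 1
    funext i
    rw [orbitVec_apply, orbitVec_apply, hy, hω]
    simp only [Pi.add_apply, Pi.smul_apply, smul_eq_mul]
    push_cast
    field_simp
  have hFqk : ∀ s k, torusNorm Γ (orbitVec A ω (s + q * k)) = torusNorm Γ (orbitVec A ω s) := by
    intro s k
    induction k with
    | zero => simp
    | succ k ih => rw [Nat.mul_succ, ← add_assoc, hFq, ih]
  have hF0 : a ≤ torusNorm Γ (orbitVec A ω 0) := by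
    by_contra! hlt
    obtain ⟨v, hv, huv⟩ := exists_mem_dualLattice_of_torusNorm_lt hlt
    apply hdual
    convert hv using 1
    funext i
    obtain ⟨k, hk⟩ := exists_int_mul_eq_of_mem_dualLattice hm hv i
    have h1 := (huv i).trans_le ha
    have h2 : orbitVec A ω 0 i = ω := by rw [orbitVec_apply]; simp
    rw [h2, lt_div_iff₀ (by positivity)] at h1
    have h3 : (ω - v i) * (L * m) = ((t * m - L * k : ℤ) : ℝ) := by
      push_cast
      rw [← hk, hω]
      field_simp
    have h4 : |((t * m - L * k : ℤ) : ℝ)| < 1 := by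
      rw [← h3, abs_mul, abs_of_pos (by positivity : (0 : ℝ) < L * m)]
      exact h1
    have h5 : (t * m - L * k : ℤ) = 0 := by
      rw [← Int.abs_lt_one_iff]
      exact_mod_cast h4
    rw [h5, Int.cast_zero] at h3
    exact sub_eq_zero.1 ((mul_eq_zero.1 h3).resolve_right (by positivity))
  set b : ℕ → ℝ := fun n => if a ≤ torusNorm Γ (orbitVec A ω n) then (1 : ℝ) else 0 with hb
  have hb0 : ∀ n, 0 ≤ b n := fun n => by simp only [hb]; split_ifs <;> norm_num
  have hlim : ∀ s < q, Tendsto (fun K : ℕ => (K : ℝ)⁻¹ * ∑ k ∈ Finset.range K, b (s + q * k)) atTop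
      (𝓝 (b s)) := by
    intro s _
    refine tendsto_const_nhds.congr' ?_
    filter_upwards [eventually_gt_atTop 0] with K hK
    have hK' : (K : ℝ) ≠ 0 := by exact_mod_cast hK.ne'
    simp only [hb, hFqk, Finset.sum_const, Finset.card_range, nsmul_eq_mul]
    rw [inv_mul_cancel_left₀ hK']
  have htot := average_tendsto_of_residues hq
    (fun n => by simp only [hb]; split_ifs <;> simp) hlim
  refine ⟨(q : ℝ)⁻¹ * ∑ s ∈ Finset.range q, b s, tendsto_ncard_div htot, ?_⟩
  have h1 : (1 : ℝ) ≤ ∑ s ∈ Finset.range q, b s := by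
    have h2 : b 0 = 1 := if_pos hF0
    rw [← h2]
    exact Finset.single_le_sum (fun n _ => hb0 n) (Finset.mem_range.2 hq)
  have h3 : (q : ℝ) ≤ (L : ℝ) ^ d := by exact_mod_cast hqL
  calc 1 / (L : ℝ) ^ d ≤ 1 / q := by gcongr
    _ = (q : ℝ)⁻¹ * 1 := by rw [one_div, mul_one]
    _ ≤ _ := by gcongr

end Rational

section Effective

/-- The bound through which `δ` is effectively positive. -/
def effectiveBound (C g : ℕ) : ℕ × ℕ × ℕ → ℕ :=
  fun p => C * (2 * p.2.2 * (p.1 + p.2.1 + 1)) ^ g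

theorem computable_effectiveBound (C g : ℕ) : Computable (effectiveBound C g) := by
  have hbase : Primrec fun p : ℕ × ℕ × ℕ => 2 * p.2.2 * (p.1 + p.2.1 + 1) := by
    have h1 : Primrec fun p : ℕ × ℕ × ℕ => p.1 := Primrec.fst
    have h2 : Primrec fun p : ℕ × ℕ × ℕ => p.2.1 := Primrec.fst.comp Primrec.snd
    have h3 : Primrec fun p : ℕ × ℕ × ℕ => p.2.2 := Primrec.snd.comp Primrec.snd
    exact Primrec.nat_mul.comp (Primrec.nat_mul.comp (Primrec.const 2) h3)
      (Primrec.nat_add.comp (Primrec.nat_add.comp h1 h2) (Primrec.const 1))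
  have hpow : ∀ g, Primrec fun p : ℕ × ℕ × ℕ => (2 * p.2.2 * (p.1 + p.2.1 + 1)) ^ g := by
    intro g
    induction g with
    | zero => simpa using Primrec.const 1
    | succ g ih => simpa only [pow_succ] using Primrec.nat_mul.comp ih hbase
  exact (Primrec.nat_mul.comp (Primrec.const C) (hpow g)).to_comp

theorem effectiveBound_mono (C g : ℕ) {M M' K K' : ℕ} (hM : M ≤ M') (hK : K ≤ K') (L : ℕ) :
    effectiveBound C g (M, K, L) ≤ effectiveBound C g (M', K', L) := by
  dsimp only [effectiveBound]
  gcongr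

end Effective

section Final

open Matrix

variable {d : ℕ} {α : ℝ}

/-- The integer polynomial with coefficients `l`. -/
noncomputable def coeffPoly (l : Fin d → ℤ) : Polynomial ℤ :=
  ∑ i : Fin d, Polynomial.C (l i) * Polynomial.X ^ (i : ℕ)

theorem aeval_coeffPoly {R : Type*} [CommRing R] (l : Fin d → ℤ) (x : R) :
    Polynomial.aeval x (coeffPoly l) = ∑ i : Fin d, (l i : R) * x ^ (i : ℕ) := by
  simp [coeffPoly]

theorem natDegree_coeffPoly_lt (hd : 0 < d) (l : Fin d → ℤ) : (coeffPoly l).natDegree < d := by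
  refine lt_of_le_of_lt (Polynomial.natDegree_sum_le_of_forall_le (n := d - 1) _ _
    fun k _ => ?_) (by omega)
  refine (Polynomial.natDegree_C_mul_X_pow_le _ _).trans ?_
  have := k.2
  omega

theorem IsSalemNumber.invEmbedding_eq (h : IsSalemNumber α) {ω : ℚ⟮α⟯} {l : Fin d → ℤ} {L : ℕ}
    (hl : IsMinimalForm α (ω : ℝ) l L) :
    h.invEmbedding ω = Polynomial.aeval (α : ℂ)⁻¹ (coeffPoly l) / L := by
  have h1 : ω = (∑ i : Fin d, (l i : ℚ⟮α⟯) *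
      IntermediateField.AdjoinSimple.gen ℚ α ^ (i : ℕ)) / (L : ℚ⟮α⟯) := by
    apply (algebraMap ℚ⟮α⟯ ℝ).injective
    rw [map_div₀, map_sum, map_natCast]
    simp only [map_mul, map_pow, map_intCast, IntermediateField.AdjoinSimple.algebraMap_gen]
    exact hl.eq
  rw [h1, map_div₀, map_sum, map_natCast, aeval_coeffPoly]
  simp only [map_mul, map_pow, map_intCast, h.invEmbedding_gen]

/-- Lower bound for the largest of the differences between `ω = P(α) / L` and its conjugates on the
unit circle. If these differences are all less than `1`, then all conjugates of `ω` are bounded in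
terms of `|ω|` and `|σ₀(ω)|`, and the Liouville-type bound applies. -/
theorem IsSalemNumber.exists_conjugate_difference_ge (h : IsSalemNumber α)
    (A : Matrix (Fin d) (Fin d) ℤ) (hA : A.charpoly.map (Int.castRingHom ℚ) = minpoly ℚ α)
    {ω : ℝ} {P : Polynomial ℤ} {L : ℕ} (hL : 0 < L) (hω : ω = Polynomial.aeval α P / L)
    {M K : ℕ} (hM : |ω| ≤ M) (hK : ‖Polynomial.aeval (α : ℂ)⁻¹ P / L‖ ≤ K)
    (hne : ∃ z ∈ upperConjugates α, Polynomial.aeval z P ≠ Polynomial.aeval (α : ℂ) P) :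
    ∃ z : upperConjugates α, 1 / ((2 * L * (M + K + 1) : ℕ) : ℝ) ^
      (Module.finrank ℚ (rootField (minpoly ℚ α)) + 1) ≤
        ‖(ω : ℂ) - Polynomial.aeval (z : ℂ) P / L‖ := by
  have hL' : (1 : ℝ) ≤ L := by exact_mod_cast hL
  have hL0 : (L : ℂ) ≠ 0 := by exact_mod_cast hL.ne'
  set g := Module.finrank ℚ (rootField (minpoly ℚ α))
  have hB : (1 : ℝ) ≤ ((2 * L * (M + K + 1) : ℕ) : ℝ) := by
    have : 1 ≤ 2 * L * (M + K + 1) := Nat.mul_pos (by omega) (by omega)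
    exact_mod_cast this
  by_cases hbig : ∃ z : upperConjugates α, 1 ≤ ‖(ω : ℂ) - Polynomial.aeval (z : ℂ) P / L‖
  · obtain ⟨z, hz⟩ := hbig
    refine ⟨z, le_trans ?_ hz⟩
    rw [div_le_one (by positivity)]
    exact one_le_pow₀ hB
  push Not at hbig
  obtain ⟨z, hz, hzne⟩ := hne
  refine ⟨⟨z, hz⟩, ?_⟩
  have hωα : Polynomial.aeval (α : ℂ) P = ω * L := by
    rw [aeval_ofReal, hω]; push_cast; field_simp
  have hdiv : ∀ (w : ℂ) (c : ℝ), ‖w / L‖ ≤ c → ‖w‖ ≤ L * c := by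
    intro w c hw
    rw [norm_div, Complex.norm_natCast, div_le_iff₀ (by linarith)] at hw
    linarith
  have hup : ∀ y ∈ upperConjugates α, ‖Polynomial.aeval y P / L‖ ≤ M + K + 1 := by
    intro y hy
    have h1 := (hbig ⟨y, hy⟩).le
    have h2 := norm_sub_norm_le (Polynomial.aeval y P / L) (ω : ℂ)
    rw [norm_sub_rev, Complex.norm_real, Real.norm_eq_abs] at h2
    have : (0 : ℝ) ≤ K := by positivity
    linarith
  have hbound : ∀ y ∈ conjugates α, ‖Polynomial.aeval y P‖ ≤ L * (M + K + 1) := by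
    intro y hy
    apply hdiv
    by_cases h1 : y = α
    · rw [h1, hωα, mul_div_cancel_right₀ _ hL0, Complex.norm_real, Real.norm_eq_abs]
      have : (0 : ℝ) ≤ K := by positivity
      linarith
    by_cases h2 : y = (α : ℂ)⁻¹
    · rw [h2]
      have : (0 : ℝ) ≤ M := by positivity
      linarith
    rcases h.upper_or_conj_upper hy (h.norm_eq_one hy h1 h2) with hu | hu
    · exact hup y hu
    · have h3 := hup _ hu
      rwa [← conj_aeval, norm_div, Complex.norm_conj, ← norm_div] at h3
  have hroot : ∀ y : ℂ, Polynomial.aeval y A.charpoly = 0 ↔ y ∈ conjugates α := fun y => by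
    rw [aeval_charpoly hA, h.mem_conjugates]
  have hH : (1 : ℝ) ≤ 2 * (L * (M + K + 1)) := by
    refine hB.trans (le_of_eq ?_)
    push_cast; ring
  have hliou := one_le_norm_sub_mul_pow (charpoly_monic A) P
    ((hroot _).2 h.self_mem_conjugates) ((hroot _).2 (mem_upperConjugates.1 hz).1)
    hzne.symm hH fun y hy => hbound y ((hroot y).1 hy)
  rw [hA] at hliou
  have hfac : Polynomial.aeval (α : ℂ) P - Polynomial.aeval z P =
      L * ((ω : ℂ) - Polynomial.aeval z P / L) := by
    rw [hωα]; field_simp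
  rw [hfac, norm_mul, Complex.norm_natCast] at hliou
  rw [div_le_iff₀ (by positivity)]
  refine hliou.trans ?_
  have hcast : ((2 * L * (M + K + 1) : ℕ) : ℝ) = 2 * (L * (M + K + 1)) := by push_cast; ring
  have hLH : (L : ℝ) ≤ 2 * (L * (M + K + 1)) := by
    have h1 : (0 : ℝ) ≤ M := by positivity
    have h2 : (0 : ℝ) ≤ K := by positivity
    nlinarith
  rw [hcast, pow_succ]
  calc _ = ‖(ω : ℂ) - Polynomial.aeval z P / L‖ * ((2 * (L * (M + K + 1))) ^ g * L) := by ring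
    _ ≤ _ := by gcongr

/-- The eigencomponents on the upper half of the unit circle are uniformly bounded from below. -/
theorem IsSalemNumber.exists_eigenComponent_ge (h : IsSalemNumber α)
    {A : Matrix (Fin d) (Fin d) ℤ} (hA : A.charpoly.map (Int.castRingHom ℚ) = minpoly ℚ α) :
    ∃ κ : ℝ, 0 < κ ∧ ∀ z : upperConjugates α, ∃ i, κ ≤ ‖eigenComponent A α z i‖ := by
  have h1 : ∀ z : upperConjugates α, ∃ i, eigenComponent A α z i ≠ 0 := fun z =>
    Function.ne_iff.1 (h.eigenComponent_ne_zero hA (mem_upperConjugates.1 z.2).1)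
  choose i hi using h1
  have hne : (Finset.univ : Finset (upperConjugates α)).Nonempty := by
    obtain ⟨z, hz⟩ := h.upperConjugates_nonempty
    exact ⟨⟨z, hz⟩, Finset.mem_univ _⟩
  obtain ⟨z₀, -, hz₀⟩ := Finset.exists_min_image Finset.univ
    (fun z : upperConjugates α => ‖eigenComponent A α z (i z)‖) hne
  exact ⟨_, norm_pos_iff.2 (hi z₀), fun z => ⟨i z, hz₀ z (Finset.mem_univ _)⟩⟩

/-- The theorem for a single `ω`, with a bound for `δ` that depends on `|ω|`, `|σ₀(ω)|` and `L`
only. -/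
theorem IsSalemNumber.exists_effective_density (h : IsSalemNumber α) (A : GL (Fin d) ℤ)
    (hA : (A : Matrix (Fin d) (Fin d) ℤ).charpoly.map (Int.castRingHom ℚ) = minpoly ℚ α)
    {Γ : Submodule ℤ (Fin d → ℤ)} (hrank : Module.finrank ℤ Γ = d) :
    ∃ C g : ℕ, ∀ (ω : ℚ⟮α⟯) (l : Fin d → ℤ) (L : ℕ), IsMinimalForm α (ω : ℝ) l L →
      (fun _ : Fin d => (ω : ℝ)) ∉ dualLattice Γ →
      ∀ M K : ℕ, |(ω : ℝ)| ≤ M → ‖h.invEmbedding ω‖ ≤ K →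
      ∃ δ : ℝ, 1 / ((effectiveBound C g (M, K, L) : ℝ) + 1) ≤ δ ∧
        ∃ f : ℝ, Tendsto (fun N : ℕ =>
          (Set.ncard {n : ℕ | n ≤ N ∧ δ ≤ torusNorm Γ (orbitVec A (ω : ℝ) n)} : ℝ) / (N : ℝ))
            atTop (𝓝 f) ∧ 1 / (2 * (L : ℝ) ^ d) ≤ f := by
  have hd : 0 < d := degree_eq hA ▸ minpoly.natDegree_pos h.isIntegral_rat
  obtain ⟨m, hm0, hm⟩ := exists_pos_smul_mem hrank
  obtain ⟨κ, hκ, hκz⟩ := h.exists_eigenComponent_ge hA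
  set g := Module.finrank ℚ (rootField (minpoly ℚ α)) with hg
  -- `128 m` ensures `2 a m ≤ 1 / 64` and `a ≤ 1 / (L m)`; `64 / κ` ensures `2 a m ≤ 2 m κ / (64 Q)`
  obtain ⟨C, hC⟩ := exists_nat_ge (64 / κ)
  refine ⟨128 * m + C, g + 1, fun ω l L hl hdual M K hM hK => ?_⟩
  have hL := hl.pos
  have hL1 : (1 : ℝ) ≤ L := by exact_mod_cast hL
  have hm1 : (1 : ℝ) ≤ m := by exact_mod_cast hm0
  have hLd : (1 : ℝ) ≤ (L : ℝ) ^ d := one_le_pow₀ hL1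
  set P := coeffPoly l with hP
  have hω : (ω : ℝ) = Polynomial.aeval α P / L := by rw [hP, aeval_coeffPoly]; exact hl.eq
  rw [h.invEmbedding_eq hl] at hK
  set Q : ℝ := ((2 * L * (M + K + 1) : ℕ) : ℝ) ^ (g + 1) with hQ
  have hLQ : (L : ℝ) ≤ Q := by
    have h1 : L ≤ 2 * L * (M + K + 1) := by nlinarith [Nat.zero_le (L * (M + K))]
    have h2 : (L : ℝ) ≤ ((2 * L * (M + K + 1) : ℕ) : ℝ) := by exact_mod_cast h1
    exact h2.trans (le_self_pow₀ (hL1.trans h2) (Nat.succ_ne_zero g))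
  have hQ1 : 1 ≤ Q := hL1.trans hLQ
  have hD : (effectiveBound (128 * m + C) (g + 1) (M, K, L) : ℝ) = (128 * m + C) * Q := by
    simp [effectiveBound, hQ]
  rw [hD]
  set a : ℝ := 1 / ((128 * m + C) * Q + 1) with ha
  have hden : (0 : ℝ) < (128 * m + C) * Q + 1 := by positivity
  have ha0 : 0 < a := by positivity
  by_cases hne : ∃ z ∈ upperConjugates α, Polynomial.aeval z P ≠ Polynomial.aeval (α : ℂ) P
  · obtain ⟨z, hz⟩ := h.exists_conjugate_difference_ge _ hA hL hω hM hK hne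
    rw [← hQ] at hz
    obtain ⟨i, hi⟩ := hκz z
    have hρz : κ / Q ≤ ‖((ω : ℝ) - Polynomial.aeval (z : ℂ) P / L) *
        eigenComponent (A : Matrix (Fin d) (Fin d) ℤ) α z i‖ := by
      rw [norm_mul]
      calc κ / Q = 1 / Q * κ := by ring
        _ ≤ _ := by gcongr
    have ham : m * (2 * a) ≤ min 1 (m * (2 * (κ / Q))) / 64 := by
      have h1 : 128 * m * a ≤ 1 := by
        rw [ha, mul_one_div, div_le_one hden]
        have : (0 : ℝ) ≤ C := by positivity
        nlinarith
      have h2 : 128 * a ≤ 2 * (κ / Q) := by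
        rw [ha, mul_one_div, ← mul_div_assoc, div_le_div_iff₀ hden (by positivity)]
        rw [div_le_iff₀ hκ] at hC
        have h3 : 64 * Q ≤ C * κ * Q := by gcongr
        have h4 : 0 ≤ κ * (128 * m * Q + 1) := by positivity
        nlinarith
      rw [le_div_iff₀ (by norm_num)]
      refine le_min (by linarith) ?_
      calc m * (2 * a) * 64 = m * (128 * a) := by ring
        _ ≤ _ := by gcongr
    obtain ⟨δ, hδ, f, hf, hf2⟩ := h.exists_density_of_rotation A hA hm0 hm hL hω z i
      (by positivity) hρz ha0 ham
    refine ⟨δ, hδ, f, hf, le_trans ?_ hf2⟩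
    gcongr
    linarith
  · push Not at hne
    have hconst := h.eq_C_of_aeval_eq (P := P)
      (by rw [degree_eq hA]; exact natDegree_coeffPoly_lt hd l) hne
    have hωt : (ω : ℝ) = (P.coeff 0 : ℤ) / L := by
      rw [hω]
      conv_lhs => rw [hconst]
      simp
    obtain ⟨f, hf, hf2⟩ := exists_density_of_rational A hm0 hm hL hωt hdual (a := a) (by
      rw [ha]
      refine one_div_le_one_div_of_le (by positivity) ?_
      have : (0 : ℝ) ≤ C := by positivity
      calc (L : ℝ) * m ≤ Q * m := by gcongr
        _ ≤ _ := by nlinarith)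
    refine ⟨a, le_rfl, f, hf, le_trans ?_ hf2⟩
    gcongr
    linarith

end Final

theorem theorem5p3 (d : ℕ) (A : GL (Fin d) ℤ) (α : ℝ) (hα : IsSalemNumber α)
    (hA : (A : Matrix (Fin d) (Fin d) ℤ).charpoly.map (Int.castRingHom ℚ) = minpoly ℚ α)
    (Γ : Submodule ℤ (Fin d → ℤ)) (hrank : Module.finrank ℤ Γ = d)
    (hinv : (∀ v ∈ Γ, (A : Matrix (Fin d) (Fin d) ℤ).mulVec v ∈ Γ) ∨
      (∀ v ∈ Γ, (A : Matrix (Fin d) (Fin d) ℤ).transpose.mulVec v ∈ Γ)) :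
    ∃ δ : ℝ → ℝ → ℕ → ℝ, IsEffectivelyPositive δ ∧
      ∀ ω : ℚ⟮α⟯, 0 < (ω : ℝ) → (ω : ℝ) < 1 →
        ∀ (l : Fin d → ℤ) (L : ℕ), IsMinimalForm α (ω : ℝ) l L →
          (fun _ : Fin d => (ω : ℝ)) ∈ dualLattice Γ ∨
          ∃ f : ℝ,
            Tendsto (fun N : ℕ =>
              (Set.ncard {n : ℕ | n ≤ N ∧
                δ |(ω : ℝ)| ‖hα.invEmbedding ω‖ L ≤ torusNorm Γ (orbitVec A (ω : ℝ) n)} : ℝ) /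
                  (N : ℝ)) atTop (𝓝 f) ∧
            1 / (2 * (L : ℝ) ^ d) ≤ f := by
  obtain ⟨C, g, hCg⟩ := hα.exists_effective_density A hA hrank
  -- A positive `ω` is determined by `x = |ω|`, so `δ x y L` may be adapted to `ω`.
  have hex : ∀ (x y : ℝ) (L : ℕ), ∃ δ : ℝ,
      1 / ((effectiveBound C g (⌈x⌉₊, ⌈y⌉₊, L) : ℝ) + 1) ≤ δ ∧
      ∀ ω : ℚ⟮α⟯, 0 < (ω : ℝ) → |(ω : ℝ)| = x → ‖hα.invEmbedding ω‖ = y →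
        ∀ l : Fin d → ℤ, IsMinimalForm α (ω : ℝ) l L →
          (fun _ : Fin d => (ω : ℝ)) ∉ dualLattice Γ →
          ∃ f : ℝ, Tendsto (fun N : ℕ =>
            (Set.ncard {n : ℕ | n ≤ N ∧ δ ≤ torusNorm Γ (orbitVec A (ω : ℝ) n)} : ℝ) / (N : ℝ))
              atTop (𝓝 f) ∧ 1 / (2 * (L : ℝ) ^ d) ≤ f := by
    intro x y L
    by_cases hx : ∃ ω : ℚ⟮α⟯, 0 < (ω : ℝ) ∧ |(ω : ℝ)| = x ∧ ‖hα.invEmbedding ω‖ = y ∧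
        ∃ l : Fin d → ℤ, IsMinimalForm α (ω : ℝ) l L ∧
          (fun _ : Fin d => (ω : ℝ)) ∉ dualLattice Γ
    · obtain ⟨ω, hpos, rfl, rfl, l, hl, hdual⟩ := hx
      obtain ⟨δ, hδ, hf⟩ := hCg ω l L hl hdual _ _ (Nat.le_ceil _) (Nat.le_ceil _)
      refine ⟨δ, hδ, fun ω' hpos' hω' _ _ _ _ => ?_⟩
      rw [abs_of_pos hpos, abs_of_pos hpos'] at hω'
      rwa [hω']
    · exact ⟨_, le_rfl, fun ω hpos h1 h2 l hl hdual => absurd ⟨ω, hpos, h1, h2, l, hl, hdual⟩ hx⟩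
  choose δ hδ hδf using hex
  refine ⟨δ, ⟨effectiveBound C g, computable_effectiveBound C g, fun x y M K L hM hK => ?_⟩,
    fun ω hpos _ l L hl => ?_⟩
  · refine le_trans ?_ (hδ x y L)
    have h1 : (effectiveBound C g (⌈x⌉₊, ⌈y⌉₊, L) : ℝ) ≤ effectiveBound C g (M, K, L) := by
      exact_mod_cast effectiveBound_mono C g (Nat.ceil_le.2 hM) (Nat.ceil_le.2 hK) L
    gcongr
  · by_cases hdual : (fun _ : Fin d => (ω : ℝ)) ∈ dualLattice Γ
    · exact Or.inl hdual
    · exact Or.inr (hδf _ _ L ω hpos rfl rfl l hl hdual)
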